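/- **Model.** Two firms $i=1,2$ are located at $z_1<z_2$ in $[0,1]$ and charge prices $p_1,p_2\ge 0$; costs are zero. There are three groups of consumers, each of mass $1$. Captive buyers of Firm 1 sit at $0$ and buy from Firm 1 iff $1-(p_1+z_1)\ge 0$; captive buyers of Firm 2 sit at $1$ and buy from Firm 2 iff $1-(p_2+1-z_2)\ge 0$. Informed consumers are uniformly distributed over $t\in(0,1)$; consumer $t$ has utility $1-(p_i+|t-z_i|)$ from Firm $i$ and buys from the firm with the higher utility if that utility is nonnegative, and otherwise buys nothing; demand of indifferent consumers is split equally. Firm $i$'s profit is $p_i$ times its total demand. A mixed price equilibrium is a pair of probability distributions on $[0,\infty)$ such that no firm can raise its expected profit by deviating to any price $p\ge0$. **Notation.** $\delta=z_2-z_1$, $\lambda_2=\frac1{2(1-z_2)}$, $\mathrm{Ei}(x)=\int_{-\infty}^x\frac{e^t}{t}\,dt$ (principal value for $x>0$), and $$g_0(p;b)=1+\frac{2}{3-z_1-2z_2-b}e^{-\lambda_2(b-p)},$$ $$g_\pi(p;b)=\frac{2\lambda_2}{p+\delta}-\frac{2\lambda_2}{b+\delta}\,\frac{1-z_1-b}{3-z_1-2z_2-b}\,e^{-\lambda_2(b-p)}-2\lambda_2^2e^{\lambda_2(p+\delta)}\bigl(\mathrm{Ei}(-\lambda_2(b+\delta))-\mathrm{Ei}(-\lambda_2(p+\delta))\bigr),$$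 $$g(p;b,\pi)=g_0(p;b)-\pi\,g_\pi(p;b),$$ $$h(p;a)=4\lambda_2e^{-\lambda_2(p-a)}-\frac{4\lambda_2(a-\delta)}{p-\delta}+4\lambda_2^2(a-\delta)e^{-\lambda_2(p-\delta)}\bigl(\mathrm{Ei}(\lambda_2(p-\delta))-\mathrm{Ei}(\lambda_2(a-\delta))\bigr).$$ **Proposition 9.** Let $\frac12\le z_1<z_2\le 1$ and $(1-2z_1+z_2)(2-z_2)>z_2$ (which forces $z_2<1$). Suppose that $0<w<1-z_1$ solves $$g_0(1-z_1-w;1-z_1)-z_2\,g_\pi(1-z_1-w;1-z_1)=0$$ and satisfies $$h(1-2z_1+z_2;\,1-2z_1+z_2-w)\le 1,$$ $$(z_2-z_1)z_2+2z_1+\frac{(1-z_2)w}{2}-\frac{z_1z_2}{1-2z_1+z_2}-\frac{(1-z_2)z_2}{1-2z_1+z_2-w}\ge 0.$$ Then there is a mixed price equilibrium in which the prices of Firm 1 and Firm 2 have the cumulative distribution functions $$F_1^\star(p)=\begin{cases}0,&p<1-z_1-w,\\ g(p;1-z_1,z_2),&1-z_1-w\le p<1-z_1,\\ 1,&p\ge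 1-z_1,\end{cases}$$ $$F_2^\star(p)=\begin{cases}0,&p<1-2z_1+z_2-w,\\ h(p;1-2z_1+z_2-w),&1-2z_1+z_2-w\le p<1-2z_1+z_2,\\ h(1-2z_1+z_2;1-2z_1+z_2-w),&1-2z_1+z_2\le p<z_2,\\ 1,&p\ge z_2.\end{cases}$$ Thus Firm 1 puts mass $1-g(1-z_1;1-z_1,z_2)$ on the price $1-z_1$, and Firm 2 puts mass $1-h(1-2z_1+z_2;1-2z_1+z_2-w)$ on the price $z_2$. The expected profits in this equilibrium are $\pi_1^\star=2(1-z_1-w)$ and $\pi_2^\star=z_2$. -/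

import Mathlib

open Set Filter Topology MeasureTheory

noncomputable section

namespace PriceGame

/-! The price subgame: captive buyers of Firm 1 sit at `0`, those of Firm 2 at `1`, and informed
consumers are uniformly distributed on `(0,1)`; each group has mass one. -/

/-- Utility of a consumer with ideal point `t` who buys at price `p` from a firm located at `z`. -/
def utility (z p t : ℝ) : ℝ := 1 - (p + |t - z|)

/-- Demand from the unit mass of captive buyers located at `e`: they buy from their own firm
exactly when this gives them nonnegative utility. -/
def captiveDemand (z e p : ℝ) : ℝ := if 0 ≤ utility z p e then 1 else 0

/-- Demand from informed consumers for the firm at `z` with price `p`, when the rival is located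
at `z'` and charges `p'`. An informed consumer buys the product of higher utility, provided that
this utility is nonnegative; the demand of indifferent consumers is split equally. -/
def informedDemand (z z' p p' : ℝ) : ℝ :=
  volume.real {t : ℝ | t ∈ Ioo (0 : ℝ) 1 ∧ 0 ≤ utility z p t ∧ utility z' p' t < utility z p t}
  + (1 / 2) * volume.real
      {t : ℝ | t ∈ Ioo (0 : ℝ) 1 ∧ 0 ≤ utility z p t ∧ utility z' p' t = utility z p t}

/-- Profit of Firm 1 at the price pair `(p₁, p₂)`. -/
def profit₁ (z₁ z₂ p₁ p₂ : ℝ) : ℝ :=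
  p₁ * (captiveDemand z₁ 0 p₁ + informedDemand z₁ z₂ p₁ p₂)

/-- Profit of Firm 2 at the price pair `(p₁, p₂)`. -/
def profit₂ (z₁ z₂ p₁ p₂ : ℝ) : ℝ :=
  p₂ * (captiveDemand z₂ 1 p₂ + informedDemand z₂ z₁ p₂ p₁)

/-- Expected profit of Firm 1 from the price `p₁` when Firm 2 draws its price from `μ₂`. -/
def expectedProfit₁ (z₁ z₂ : ℝ) (μ₂ : Measure ℝ) (p₁ : ℝ) : ℝ :=
  ∫ p₂, profit₁ z₁ z₂ p₁ p₂ ∂μ₂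

/-- Expected profit of Firm 2 from the price `p₂` when Firm 1 draws its price from `μ₁`. -/
def expectedProfit₂ (z₁ z₂ : ℝ) (μ₁ : Measure ℝ) (p₂ : ℝ) : ℝ :=
  ∫ p₁, profit₂ z₁ z₂ p₁ p₂ ∂μ₁

/-- Expected profit of Firm 1 under the mixed strategy profile `(μ₁, μ₂)`. -/
def mixedProfit₁ (z₁ z₂ : ℝ) (μ₁ μ₂ : Measure ℝ) : ℝ := ∫ p₁, expectedProfit₁ z₁ z₂ μ₂ p₁ ∂μ₁

/-- Expected profit of Firm 2 under the mixed strategy profile `(μ₁, μ₂)`. -/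
def mixedProfit₂ (z₁ z₂ : ℝ) (μ₁ μ₂ : Measure ℝ) : ℝ := ∫ p₂, expectedProfit₂ z₁ z₂ μ₁ p₂ ∂μ₂

/-- A mixed strategy: a probability distribution of nonnegative prices. -/
structure IsMixedStrategy (μ : Measure ℝ) : Prop where
  isProbabilityMeasure : IsProbabilityMeasure μ
  nonneg : μ (Iio 0) = 0

/-- A (mixed strategy Nash) price equilibrium: no firm can increase its expected profit by
deviating to any nonnegative price. -/
structure IsPriceEquilibrium (z₁ z₂ : ℝ) (μ₁ μ₂ : Measure ℝ) : Prop where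
  strategy₁ : IsMixedStrategy μ₁
  strategy₂ : IsMixedStrategy μ₂
  noDeviation₁ : ∀ p : ℝ, 0 ≤ p → expectedProfit₁ z₁ z₂ μ₂ p ≤ mixedProfit₁ z₁ z₂ μ₁ μ₂
  noDeviation₂ : ∀ p : ℝ, 0 ≤ p → expectedProfit₂ z₁ z₂ μ₁ p ≤ mixedProfit₂ z₁ z₂ μ₁ μ₂

/-- The exponential integral `Ei x = ∫_{-∞}^x exp t / t dt`, for `x ≠ 0`
(Cauchy principal value at `t = 0` when `x > 0`). -/
def Ei (x : ℝ) : ℝ :=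
  limUnder (𝓝[>] (0 : ℝ)) fun ε => ∫ t in Iic x \ Ioo (-ε) ε, Real.exp t / t

/-- The constant `λ₂ = 1 / (2 (1 - z₂))`. -/
def lam₂ (z₂ : ℝ) : ℝ := 1 / (2 * (1 - z₂))

/-- The function `g₀(p; b)`. -/
def g₀ (z₁ z₂ p b : ℝ) : ℝ :=
  1 + 2 / (3 - z₁ - 2 * z₂ - b) * Real.exp (-lam₂ z₂ * (b - p))

/-- The function `g_π(p; b)`, with `δ = z₂ - z₁`. -/
def gπ (z₁ z₂ p b : ℝ) : ℝ :=
  2 * lam₂ z₂ / (p + (z₂ - z₁))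
  - 2 * lam₂ z₂ / (b + (z₂ - z₁)) * ((1 - z₁ - b) / (3 - z₁ - 2 * z₂ - b))
      * Real.exp (-lam₂ z₂ * (b - p))
  - 2 * lam₂ z₂ ^ 2 * Real.exp (lam₂ z₂ * (p + (z₂ - z₁)))
      * (Ei (-lam₂ z₂ * (b + (z₂ - z₁))) - Ei (-lam₂ z₂ * (p + (z₂ - z₁))))

/-- The function `g(p; b, π) = g₀(p; b) - π g_π(p; b)`. -/
def g (z₁ z₂ p b π : ℝ) : ℝ := g₀ z₁ z₂ p b - π * gπ z₁ z₂ p b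

/-- The function `h(p; a)`, with `δ = z₂ - z₁`. -/
def h (z₁ z₂ p a : ℝ) : ℝ :=
  4 * lam₂ z₂ * Real.exp (-lam₂ z₂ * (p - a))
  - 4 * lam₂ z₂ * (a - (z₂ - z₁)) / (p - (z₂ - z₁))
  + 4 * lam₂ z₂ ^ 2 * (a - (z₂ - z₁)) * Real.exp (-lam₂ z₂ * (p - (z₂ - z₁)))
      * (Ei (lam₂ z₂ * (p - (z₂ - z₁))) - Ei (lam₂ z₂ * (a - (z₂ - z₁))))

/-- The cumulative distribution function of Firm 1's price. -/
def F₁ (z₁ z₂ w p : ℝ) : ℝ :=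
  if p < 1 - z₁ - w then 0
  else if p < 1 - z₁ then g z₁ z₂ p (1 - z₁) z₂
  else 1

/-- The cumulative distribution function of Firm 2's price. -/
def F₂ (z₁ z₂ w p : ℝ) : ℝ :=
  if p < 1 - 2 * z₁ + z₂ - w then 0
  else if p < 1 - 2 * z₁ + z₂ then h z₁ z₂ p (1 - 2 * z₁ + z₂ - w)
  else if p < z₂ then h z₁ z₂ (1 - 2 * z₁ + z₂) (1 - 2 * z₁ + z₂ - w)
  else 1

end PriceGame

end

open Set Filter Topology MeasureTheory

noncomputable section

namespace PriceGame


/-! The candidate strategies are verified directly. Firm 2's interval of prices is Firm 1's interval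
shifted by δ. Hence against a price `p` of Firm 1, every price of Firm 2 above `p + δ` gives Firm 1
the whole informed market, while a price below `p + δ` splits it affinely, provided Firm 1 is never
itself undercut by δ; that proviso is `w < 2δ` (`width_lt`).

Each firm's indifference is then a first-order linear differential equation for the rival's
distribution function, solved by `g` and `h` because `Ei' = exp x / x`. Solving the equation for the
function itself gives the explicit primitives `prim₁`, `prim₂`, so expected profits (integrals of
piecewise affine functions) reduce to algebra: `integral_indifference₁`, `integral_indifference₂`.
Monotonicity holds because each density solves an equation along which nonnegativity passes
leftwards from the right end.

Of the deviations off the supports, only two need real work: Firm 1 giving up its captives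
(`mul_informedDemand₁_le`, `width_le_sq`) and Firm 2 undercutting Firm 1 by more than δ
(`undercut_le`). The latter pays most at `1 - z₂`, which beats Firm 1's atom, and there the second
condition on `w` bounds it by `z₂`. Ties affect only null sets, or are absorbed by upper bounds. -/

/-! ### The exponential integral and its derivative. -/

theorem integrableOn_exp_div_Iic {x : ℝ} (hx : x < 0) :
    IntegrableOn (fun t : ℝ => Real.exp t / t) (Iic x) := by
  have h1 : IntegrableOn (fun t : ℝ => Real.exp t / (-x)) (Iic x) :=
    (integrableOn_exp_Iic x).div_const _
  refine Integrable.mono' h1 ?_ ?_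
  · exact (Real.measurable_exp.div measurable_id).aestronglyMeasurable
  · refine (ae_restrict_iff' measurableSet_Iic).2 (ae_of_all _ fun t ht => ?_)
    have ht' : t ≤ x := ht
    rw [norm_div, Real.norm_eq_abs, Real.norm_eq_abs, abs_of_pos (Real.exp_pos t),
      abs_of_neg (by linarith)]
    exact div_le_div_of_nonneg_left (Real.exp_pos t).le (by linarith) (by linarith)

theorem intervalIntegrable_exp_div {x y : ℝ} (h : (0 : ℝ) ∉ uIcc x y) :
    IntervalIntegrable (fun t : ℝ => Real.exp t / t) volume x y := by
  refine ContinuousOn.intervalIntegrable fun t ht => ?_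
  have : t ≠ 0 := fun h0 => h (h0 ▸ ht)
  exact (Real.continuous_exp.continuousAt.div continuousAt_id this).continuousWithinAt

/-- Once `ε < -x` the excised interval misses `(-∞, x]`, so the truncated integral is eventually
constant. -/
theorem Ei_of_neg {x : ℝ} (hx : x < 0) : Ei x = ∫ t in Iic x, Real.exp t / t := by
  refine Tendsto.limUnder_eq (tendsto_const_nhds.congr' ?_)
  have : ∀ᶠ ε in 𝓝[>] (0 : ℝ), ε < -x :=
    nhdsWithin_le_nhds (Iio_mem_nhds (by linarith))
  filter_upwards [this] with ε hε
  have : Iic x \ Ioo (-ε) ε = Iic x := by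
    ext t
    simp only [Set.mem_sdiff, mem_Iic, mem_Ioo, not_and, not_lt, and_iff_left_iff_imp]
    intro h1 h2
    linarith
  rw [this]

/-- The difference of the two one-sided parts of the principal value is an integral of the
continuous function `sinh t / t`. -/
theorem integral_exp_div_symm {ε : ℝ} (hε : 0 < ε) (hε1 : ε < 1) :
    (∫ t in Iic (-ε), Real.exp t / t) + ∫ t in ε..1, Real.exp t / t
      = (∫ t in Iic (-1 : ℝ), Real.exp t / t)
        + ∫ t in ε..1, 2 * dslope Real.sinh 0 t := by
  have h1 := intervalIntegral.integral_Iic_sub_Iic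
    (integrableOn_exp_div_Iic (x := -1) (by norm_num))
    (integrableOn_exp_div_Iic (x := -ε) (by linarith))
  have hn : (0 : ℝ) ∉ uIcc ε 1 := by
    rw [uIcc_of_le hε1.le]; intro h; linarith [h.1]
  have hn' : (0 : ℝ) ∉ uIcc (-1) (-ε) := by
    rw [uIcc_of_le (by linarith)]; intro h; linarith [h.2]
  have h2 : ∫ t in (-1 : ℝ)..(-ε), Real.exp t / t = ∫ t in ε..1, Real.exp (-t) / (-t) :=
    (intervalIntegral.integral_comp_neg (fun t : ℝ => Real.exp t / t)).symm
  have h3 : IntervalIntegrable (fun t : ℝ => Real.exp (-t) / (-t)) volume ε 1 := by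
    refine ContinuousOn.intervalIntegrable fun t ht => ?_
    have : t ≠ 0 := fun h0 => hn (h0 ▸ ht)
    exact ((Real.continuous_exp.comp continuous_neg).continuousAt.div
      continuous_neg.continuousAt (neg_ne_zero.2 this)).continuousWithinAt
  have h4 : (∫ t in ε..1, Real.exp (-t) / (-t)) + ∫ t in ε..1, Real.exp t / t
      = ∫ t in ε..1, 2 * dslope Real.sinh 0 t := by
    rw [← intervalIntegral.integral_add h3 (intervalIntegrable_exp_div hn)]
    refine intervalIntegral.integral_congr fun t ht => ?_
    have ht0 : t ≠ 0 := fun h0 => hn (h0 ▸ ht)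
    simp only [dslope_of_ne _ ht0, slope_def_field, Real.sinh_eq, sub_zero, neg_zero, sub_self,
      zero_div]
    field_simp
    ring
  linarith

theorem continuous_dslope_sinh : Continuous (dslope Real.sinh 0) := by
  rw [← continuousOn_univ, continuousOn_dslope univ_mem]
  exact ⟨Real.continuous_sinh.continuousOn, Real.differentiable_sinh 0⟩

/-- The principal value exists because folding the two sides at `0` leaves the continuous integrand
`2 sinh t / t`. The value of `C` is immaterial: only the derivative of `Ei` is used. -/
theorem exists_Ei_eq_add_integral :
    ∃ C : ℝ, ∀ x : ℝ, 0 < x → Ei x = C + ∫ t in (1 : ℝ)..x, Real.exp t / t := by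
  refine ⟨(∫ t in Iic (-1 : ℝ), Real.exp t / t) + ∫ t in (0 : ℝ)..1, 2 * dslope Real.sinh 0 t,
    fun x hx => Tendsto.limUnder_eq ?_⟩
  have hc : Continuous fun t : ℝ => 2 * dslope Real.sinh 0 t :=
    continuous_const.mul continuous_dslope_sinh
  have ht : Tendsto (fun ε : ℝ => ((∫ t in Iic (-1 : ℝ), Real.exp t / t)
      + ∫ t in ε..1, 2 * dslope Real.sinh 0 t) + ∫ t in (1 : ℝ)..x, Real.exp t / t) (𝓝[>] 0)
      (𝓝 (((∫ t in Iic (-1 : ℝ), Real.exp t / t)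
      + ∫ t in (0 : ℝ)..1, 2 * dslope Real.sinh 0 t) + ∫ t in (1 : ℝ)..x, Real.exp t / t)) := by
    have : Continuous fun ε : ℝ => ∫ t in ε..1, 2 * dslope Real.sinh 0 t := by
      simp_rw [fun ε : ℝ => intervalIntegral.integral_symm (μ := volume)
        (f := fun t => 2 * dslope Real.sinh 0 t) (1 : ℝ) ε]
      exact (intervalIntegral.continuous_primitive (fun a b => hc.intervalIntegrable a b) 1).neg
    exact ((this.tendsto 0).mono_left nhdsWithin_le_nhds).const_add _ |>.add_const _
  refine ht.congr' ?_
  have h1 : ∀ᶠ ε in 𝓝[>] (0 : ℝ), ε < min x 1 :=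
    nhdsWithin_le_nhds (Iio_mem_nhds (by positivity))
  filter_upwards [h1, self_mem_nhdsWithin] with ε hε hε0
  have hε0 : 0 < ε := hε0
  have hεx : ε < x := hε.trans_le (min_le_left _ _)
  have hε1 : ε < 1 := hε.trans_le (min_le_right _ _)
  have hset : Iic x \ Ioo (-ε) ε = Iic (-ε) ∪ Icc ε x := by
    ext t
    simp only [Set.mem_sdiff, mem_Iic, mem_Ioo, not_and, not_lt, mem_union, mem_Icc]
    constructor
    · rintro ⟨h1, h2⟩
      by_cases h : t ≤ -ε
      · exact Or.inl h
      · exact Or.inr ⟨h2 (by linarith), h1⟩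
    · rintro (h | h)
      · exact ⟨by linarith, fun h' => by linarith⟩
      · exact ⟨h.2, fun _ => h.1⟩
  have hn : ∀ u v : ℝ, 0 < u → 0 < v → (0 : ℝ) ∉ uIcc u v := fun u v hu hv h =>
    absurd h.1 (not_le.2 (lt_min hu hv))
  have hii := intervalIntegrable_exp_div (hn ε x hε0 hx)
  rw [hset, setIntegral_union _ measurableSet_Icc (integrableOn_exp_div_Iic (by linarith))
    ((intervalIntegrable_iff_integrableOn_Icc_of_le hεx.le).1 hii), integral_Icc_eq_integral_Ioc,
    ← intervalIntegral.integral_of_le hεx.le, ← integral_exp_div_symm hε0 hε1, add_assoc,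
    intervalIntegral.integral_add_adjacent_intervals
      (intervalIntegrable_exp_div (hn ε 1 hε0 one_pos))
      (intervalIntegrable_exp_div (hn 1 x one_pos hx))]
  exact Set.disjoint_left.2 fun t h1 h2 => by
    have := h2.1; have : t ≤ -ε := h1; linarith

theorem hasDerivAt_integral_exp_div {x y : ℝ} (h : (0 : ℝ) ∉ uIcc x y) :
    HasDerivAt (fun u => ∫ t in x..u, Real.exp t / t) (Real.exp y / y) y := by
  have hy : y ≠ 0 := fun h0 => h (h0 ▸ right_mem_uIcc)
  refine intervalIntegral.integral_hasDerivAt_right (intervalIntegrable_exp_div h) ?_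
    (Real.continuous_exp.continuousAt.div continuousAt_id hy)
  exact (Real.measurable_exp.div measurable_id).stronglyMeasurable.stronglyMeasurableAtFilter

theorem hasDerivAt_Ei {x : ℝ} (hx : x ≠ 0) : HasDerivAt Ei (Real.exp x / x) x := by
  rcases lt_or_gt_of_ne hx with hx | hx
  · have h0 : (0 : ℝ) ∉ uIcc x x := by simp [hx.ne']
    have h1 := (hasDerivAt_integral_exp_div h0).const_add (Ei x)
    refine h1.congr_of_eventuallyEq ?_
    filter_upwards [Iio_mem_nhds hx] with y hy
    have hy : y < 0 := hy
    have := intervalIntegral.integral_Iic_sub_Iic (integrableOn_exp_div_Iic hx)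
      (integrableOn_exp_div_Iic hy)
    rw [Ei_of_neg hx, Ei_of_neg hy]
    linarith
  · obtain ⟨C, hC⟩ := exists_Ei_eq_add_integral
    have h0 : (0 : ℝ) ∉ uIcc 1 x := fun h => absurd h.1 (not_le.2 (lt_min one_pos hx))
    have h1 := (hasDerivAt_integral_exp_div h0).const_add C
    refine h1.congr_of_eventuallyEq ?_
    filter_upwards [Ioi_mem_nhds hx] with y hy using hC y hy

/-! ### The differential equations satisfied by `g` and `h`. -/

/-- `g(·; 1 - z₁, π)` solves the linear differential equation of Firm 2's indifference. -/
theorem hasDerivAt_g {z₁ z₂ π t : ℝ} (hz₂ : z₂ < 1) (ht : 0 < t + (z₂ - z₁)) :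
    HasDerivAt (fun p => g z₁ z₂ p (1 - z₁) π)
      (lam₂ z₂ * (g z₁ z₂ t (1 - z₁) π - 1) + 2 * lam₂ z₂ * π / (t + (z₂ - z₁)) ^ 2) t := by
  have hl : 0 < lam₂ z₂ := by unfold lam₂; apply one_div_pos.2; linarith
  unfold g g₀ gπ
  set L := lam₂ z₂
  have e1 : HasDerivAt (fun p => Real.exp (-L * (1 - z₁ - p)))
      (Real.exp (-L * (1 - z₁ - t)) * (-L * (-1))) t :=
    (((hasDerivAt_id t).const_sub (1 - z₁)).const_mul (-L)).exp
  have e2 : HasDerivAt (fun p => Real.exp (L * (p + (z₂ - z₁))))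
      (Real.exp (L * (t + (z₂ - z₁))) * (L * 1)) t :=
    (((hasDerivAt_id t).add_const (z₂ - z₁)).const_mul L).exp
  have e3 : HasDerivAt (fun p => Ei (-L * (p + (z₂ - z₁))))
      (Real.exp (-L * (t + (z₂ - z₁))) / (-L * (t + (z₂ - z₁))) * (-L * 1)) t :=
    (hasDerivAt_Ei (by nlinarith [mul_pos hl ht])).comp t
      (((hasDerivAt_id t).add_const (z₂ - z₁)).const_mul (-L))
  have e4 : HasDerivAt (fun p => 2 * L / (p + (z₂ - z₁)))
      ((0 * (t + (z₂ - z₁)) - 2 * L * 1) / (t + (z₂ - z₁)) ^ 2) t :=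
    (hasDerivAt_const t (2 * L)).div ((hasDerivAt_id t).add_const (z₂ - z₁)) ht.ne'
  have := ((e1.const_mul (2 / (3 - z₁ - 2 * z₂ - (1 - z₁)))).const_add 1).sub
    (((e4.sub (e1.const_mul (2 * L / (1 - z₁ + (z₂ - z₁)) * ((1 - z₁ - (1 - z₁)) / (3 - z₁ - 2 * z₂ - (1 - z₁)))))).sub
    ((e2.const_mul (2 * L ^ 2)).mul (e3.const_sub (Ei (-L * (1 - z₁ + (z₂ - z₁))))))).const_mul π)
  refine this.congr_deriv ?_
  have he : Real.exp (-L * (t + (z₂ - z₁))) = (Real.exp (L * (t + (z₂ - z₁))))⁻¹ := by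
    rw [← Real.exp_neg]; ring_nf
  rw [he]
  have hE := Real.exp_pos (L * (t + (z₂ - z₁)))
  simp only [sub_self, zero_div, mul_zero, zero_mul, sub_zero, zero_sub]
  field_simp
  ring

theorem g_right {z₁ z₂ π : ℝ} (hz₂ : z₂ < 1) :
    g z₁ z₂ (1 - z₁) (1 - z₁) π = 1 - (π / (1 - 2 * z₁ + z₂) - 1) / (1 - z₂) := by
  unfold g g₀ gπ lam₂
  have h1 : (1 - z₂) ≠ 0 := by linarith
  have h2 : 3 - z₁ - 2 * z₂ - (1 - z₁) = 2 * (1 - z₂) := by ring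
  have h3 : 1 - z₁ + (z₂ - z₁) = 1 - 2 * z₁ + z₂ := by ring
  simp only [sub_self, mul_zero, Real.exp_zero, zero_div, zero_mul, h2, h3]
  generalize 1 - 2 * z₁ + z₂ = c
  -- With `π / 0 = 0` both sides still agree, so no positivity of `c` has to be assumed.
  by_cases hc : c = 0
  · subst hc; field_simp; ring
  · field_simp; ring

/-- `h(·; a)` solves the linear differential equation of Firm 1's indifference. -/
theorem hasDerivAt_h {z₁ z₂ a t : ℝ} (hz₂ : z₂ < 1)
    (ht : 0 < t - (z₂ - z₁)) :
    HasDerivAt (fun p => h z₁ z₂ p a)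
      (lam₂ z₂ * (4 * (a - (z₂ - z₁)) / (t - (z₂ - z₁)) ^ 2 - h z₁ z₂ t a)) t := by
  have hl : 0 < lam₂ z₂ := by unfold lam₂; apply one_div_pos.2; linarith
  unfold h
  set L := lam₂ z₂
  have hLt : L * (t - (z₂ - z₁)) ≠ 0 := (mul_pos hl ht).ne'
  have e1 : HasDerivAt (fun p => Real.exp (-L * (p - a)))
      (Real.exp (-L * (t - a)) * (-L * 1)) t :=
    (((hasDerivAt_id t).sub_const a).const_mul (-L)).exp
  have e2 : HasDerivAt (fun p => Real.exp (-L * (p - (z₂ - z₁))))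
      (Real.exp (-L * (t - (z₂ - z₁))) * (-L * 1)) t :=
    (((hasDerivAt_id t).sub_const (z₂ - z₁)).const_mul (-L)).exp
  have e3 : HasDerivAt (fun p => Ei (L * (p - (z₂ - z₁))))
      (Real.exp (L * (t - (z₂ - z₁))) / (L * (t - (z₂ - z₁))) * (L * 1)) t :=
    HasDerivAt.comp t (h₂ := Ei) (hasDerivAt_Ei hLt)
      (((hasDerivAt_id t).sub_const (z₂ - z₁)).const_mul L)
  have e4 : HasDerivAt (fun p => 4 * L * (a - (z₂ - z₁)) / (p - (z₂ - z₁)))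
      ((0 * (t - (z₂ - z₁)) - 4 * L * (a - (z₂ - z₁)) * 1) / (t - (z₂ - z₁)) ^ 2) t :=
    (hasDerivAt_const t _).div ((hasDerivAt_id t).sub_const (z₂ - z₁)) ht.ne'
  have := ((e1.const_mul (4 * L)).sub e4).add
    ((e2.const_mul (4 * L ^ 2 * (a - (z₂ - z₁)))).mul
      (e3.sub_const (Ei (L * (a - (z₂ - z₁))))))
  refine this.congr_deriv ?_
  have he : Real.exp (-L * (t - (z₂ - z₁))) = (Real.exp (L * (t - (z₂ - z₁))))⁻¹ := by
    rw [← Real.exp_neg]; ring_nf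
  rw [he]
  have hE := Real.exp_pos (L * (t - (z₂ - z₁)))
  field_simp
  ring

theorem h_left {z₁ z₂ a : ℝ} (ha : 0 < a - (z₂ - z₁)) : h z₁ z₂ a a = 0 := by
  unfold h
  rw [sub_self, sub_self, mul_zero, Real.exp_zero, mul_div_assoc, div_self ha.ne']
  ring


/-! ### Integration against a density plus an atom. -/

/-- The measure with density `f` on `(l, r]` and an additional atom of mass `c` at `x₀`. -/
def densityWithAtom (f : ℝ → ℝ) (l r c x₀ : ℝ) : Measure ℝ :=
  (volume.restrict (Ioc l r)).withDensity (fun t => ENNReal.ofReal (f t))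
    + ENNReal.ofReal c • Measure.dirac x₀

theorem ae_densityWithAtom {f : ℝ → ℝ} {l r c x₀ : ℝ} {P : ℝ → Prop}
    (h : ∀ t ∈ Ioc l r, P t) (h₀ : P x₀) : ∀ᵐ t ∂densityWithAtom f l r c x₀, P t := by
  unfold densityWithAtom
  rw [ae_add_measure_iff]
  constructor
  · exact withDensity_absolutelyContinuous _ _
      ((ae_restrict_iff' measurableSet_Ioc).2 (ae_of_all _ h))
  · refine Measure.ae_smul_measure ?_ _
    rw [ae_dirac_eq]
    exact h₀

section

variable {F f Φ : ℝ → ℝ} {l r c x₀ s A B C D : ℝ} {ψ : ℝ → ℝ}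

/-- Integration by parts, with `F` a primitive of the density and `Φ` a primitive of `F`. The
integrand is prescribed only on the open interval, so profits at tie prices never have to be
computed. -/
theorem integral_density_mul_affine (hlr : l ≤ r)
    (hF : ∀ t ∈ Icc l r, HasDerivAt F (f t) t) (hΦ : ∀ t ∈ Icc l r, HasDerivAt Φ (F t) t)
    (hf : ContinuousOn f (Icc l r)) (hψ : ∀ t ∈ Ioo l r, ψ t = A + B * t) :
    IntegrableOn (fun t => f t * ψ t) (Ioc l r) ∧
      ∫ t in Ioc l r, f t * ψ t
        = ((A + B * r) * F r - B * Φ r) - ((A + B * l) * F l - B * Φ l) := by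
  have hi : IntegrableOn (fun t => f t * (A + B * t)) (Ioc l r) := by
    have : ContinuousOn (fun t => f t * (A + B * t)) (Icc l r) :=
      hf.mul (Continuous.continuousOn (by fun_prop))
    exact (this.integrableOn_compact isCompact_Icc).mono_set Ioc_subset_Icc_self
  have hae : (fun t => f t * (A + B * t)) =ᵐ[volume.restrict (Ioc l r)] fun t => f t * ψ t := by
    have hr : ∀ᵐ t : ℝ, t ≠ r := by simp [ae_iff]
    rw [EventuallyEq, ae_restrict_iff' measurableSet_Ioc]
    filter_upwards [hr] with t htr ht
    rw [hψ t ⟨ht.1, lt_of_le_of_ne ht.2 htr⟩]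
  refine ⟨hi.congr hae, ?_⟩
  rw [← integral_congr_ae hae, ← intervalIntegral.integral_of_le hlr]
  refine intervalIntegral.integral_eq_sub_of_hasDerivAt
    (f := fun t => (A + B * t) * F t - B * Φ t) (fun t ht => ?_)
    ((intervalIntegrable_iff_integrableOn_Ioc_of_le hlr).2 hi)
  rw [uIcc_of_le hlr] at ht
  have h1 : HasDerivAt (fun t => A + B * t) (B * 1) t :=
    ((hasDerivAt_id t).const_mul B).const_add A
  refine ((h1.mul (hF t ht)).sub ((hΦ t ht).const_mul B)).congr_deriv ?_
  ring

/-- Integral of a piecewise affine function with one break. -/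
theorem integral_densityWithAtom
    (hF : ∀ t ∈ Icc l r, HasDerivAt F (f t) t) (hΦ : ∀ t ∈ Icc l r, HasDerivAt Φ (F t) t)
    (hf : ContinuousOn f (Icc l r)) (hf0 : ∀ t ∈ Icc l r, 0 ≤ f t) (hc : 0 ≤ c)
    (hs : s ∈ Icc l r) (hψ₁ : ∀ t ∈ Ioo l s, ψ t = A + B * t)
    (hψ₂ : ∀ t ∈ Ioo s r, ψ t = C + D * t) :
    Integrable ψ (densityWithAtom f l r c x₀) ∧
      ∫ t, ψ t ∂densityWithAtom f l r c x₀
        = ((A + B * s) * F s - B * Φ s) - ((A + B * l) * F l - B * Φ l)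
          + (((C + D * r) * F r - D * Φ r) - ((C + D * s) * F s - D * Φ s)) + c * ψ x₀ := by
  have sub₁ : Icc l s ⊆ Icc l r := Icc_subset_Icc_right hs.2
  have sub₂ : Icc s r ⊆ Icc l r := Icc_subset_Icc_left hs.1
  obtain ⟨i₁, e₁⟩ := integral_density_mul_affine hs.1 (fun t ht => hF t (sub₁ ht))
    (fun t ht => hΦ t (sub₁ ht)) (hf.mono sub₁) hψ₁
  obtain ⟨i₂, e₂⟩ := integral_density_mul_affine hs.2 (fun t ht => hF t (sub₂ ht))
    (fun t ht => hΦ t (sub₂ ht)) (hf.mono sub₂) hψ₂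
  have hu : Ioc l s ∪ Ioc s r = Ioc l r := Ioc_union_Ioc_eq_Ioc hs.1 hs.2
  have hi : IntegrableOn (fun t => f t * ψ t) (Ioc l r) := hu ▸ i₁.union i₂
  have he : ∫ t in Ioc l r, f t * ψ t
      = (∫ t in Ioc l s, f t * ψ t) + ∫ t in Ioc s r, f t * ψ t := by
    rw [← hu, setIntegral_union (Ioc_disjoint_Ioc_of_le le_rfl) measurableSet_Ioc i₁ i₂]
  have hm : AEMeasurable (fun t => ENNReal.ofReal (f t)) (volume.restrict (Ioc l r)) :=
    ((hf.mono Ioc_subset_Icc_self).aemeasurable measurableSet_Ioc).ennreal_ofReal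
  have hfin : ∀ᵐ t ∂volume.restrict (Ioc l r), ENNReal.ofReal (f t) < ⊤ :=
    ae_of_all _ fun _ => ENNReal.ofReal_lt_top
  have hae : (fun t => f t * ψ t) =ᵐ[volume.restrict (Ioc l r)]
      fun t => (ENNReal.ofReal (f t)).toReal • ψ t := by
    refine (ae_restrict_iff' measurableSet_Ioc).2 (ae_of_all _ fun t ht => ?_)
    simp only [ENNReal.toReal_ofReal (hf0 t (Ioc_subset_Icc_self ht)), smul_eq_mul]
  have j₁ : Integrable ψ
      ((volume.restrict (Ioc l r)).withDensity (fun t => ENNReal.ofReal (f t))) :=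
    (integrable_withDensity_iff_integrable_smul₀' hm hfin).2 (hi.congr hae)
  have j₂ : Integrable ψ (ENNReal.ofReal c • Measure.dirac x₀) :=
    (integrable_dirac (by simp)).smul_measure ENNReal.ofReal_ne_top
  refine ⟨j₁.add_measure j₂, ?_⟩
  unfold densityWithAtom
  rw [integral_add_measure j₁ j₂, integral_withDensity_eq_integral_toReal_smul₀ hm hfin,
    ← integral_congr_ae hae, he, e₁, e₂, integral_smul_measure, integral_dirac,
    ENNReal.toReal_ofReal hc, smul_eq_mul]

theorem measureReal_densityWithAtom {S : Set ℝ} (hS : MeasurableSet S)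
    (hF : ∀ t ∈ Icc l r, HasDerivAt F (f t) t) (hΦ : ∀ t ∈ Icc l r, HasDerivAt Φ (F t) t)
    (hf : ContinuousOn f (Icc l r)) (hf0 : ∀ t ∈ Icc l r, 0 ≤ f t) (hc : 0 ≤ c)
    (hs : s ∈ Icc l r) (h₁ : Ioo l s ⊆ S) (h₂ : Disjoint (Ioo s r) S) :
    (densityWithAtom f l r c x₀).real S = F s - F l + c * S.indicator 1 x₀ := by
  have := (integral_densityWithAtom (c := c) (x₀ := x₀) (ψ := S.indicator 1) (A := 1) (B := 0)
    (C := 0) (D := 0) hF hΦ hf hf0 hc hs (fun t ht => by simp [indicator_of_mem (h₁ ht)])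
    (fun t ht => by simp [indicator_of_notMem (Set.disjoint_left.1 h₂ ht)])).2
  rw [integral_indicator_one hS] at this
  rw [this]
  ring

theorem isProbabilityMeasure_densityWithAtom (hlr : l ≤ r)
    (hF : ∀ t ∈ Icc l r, HasDerivAt F (f t) t) (hΦ : ∀ t ∈ Icc l r, HasDerivAt Φ (F t) t)
    (hf : ContinuousOn f (Icc l r)) (hf0 : ∀ t ∈ Icc l r, 0 ≤ f t) (hc : 0 ≤ c)
    (hl : F l = 0) (hr : c = 1 - F r) :
    IsProbabilityMeasure (densityWithAtom f l r c x₀) := by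
  have := measureReal_densityWithAtom (x₀ := x₀) MeasurableSet.univ hF hΦ hf hf0 hc
    (right_mem_Icc.2 hlr) (subset_univ _) (by simp)
  rw [indicator_univ, Pi.one_apply, hl, measureReal_def] at this
  refine ⟨?_⟩
  rw [← ENNReal.toReal_eq_one_iff, this, hr]
  ring

end


/-! ### Demand of the informed consumers. -/

theorem continuous_utility (z p : ℝ) : Continuous (utility z p) := by
  unfold utility; fun_prop

theorem informedDemand_nonneg (z z' p p' : ℝ) : 0 ≤ informedDemand z z' p p' := by
  unfold informedDemand
  positivity

/-- Counting indifferent consumers fully instead of by half only enlarges demand; this handles ties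
in all the upper bounds. -/
theorem informedDemand_le {z z' p p' : ℝ} {S : Set ℝ} (hS : volume S ≠ ⊤)
    (h : ∀ t ∈ Ioo (0 : ℝ) 1, 0 ≤ utility z p t → utility z' p' t ≤ utility z p t → t ∈ S) :
    informedDemand z z' p p' ≤ volume.real S := by
  have c := (continuous_utility z p).measurable
  have c' := (continuous_utility z' p').measurable
  set A := {t : ℝ | t ∈ Ioo (0 : ℝ) 1 ∧ 0 ≤ utility z p t ∧ utility z' p' t < utility z p t}
    with hA
  set B := {t : ℝ | t ∈ Ioo (0 : ℝ) 1 ∧ 0 ≤ utility z p t ∧ utility z' p' t = utility z p t}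
    with hB
  have hBm : MeasurableSet B := measurableSet_Ioo.inter
    ((measurableSet_le measurable_const c).inter (measurableSet_eq_fun c' c))
  have hdisj : Disjoint A B := Set.disjoint_left.2 fun t h₁ h₂ => h₁.2.2.ne h₂.2.2
  have hsub : A ∪ B ⊆ S := by
    rintro t (ht | ht)
    · exact h t ht.1 ht.2.1 ht.2.2.le
    · exact h t ht.1 ht.2.1 ht.2.2.le
  have hAS : volume A ≠ ⊤ := measure_ne_top_of_subset (subset_union_left.trans hsub) hS
  have hBS : volume B ≠ ⊤ := measure_ne_top_of_subset (subset_union_right.trans hsub) hS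
  have h1 := measureReal_union hdisj hBm hAS hBS
  have h2 := measureReal_mono hsub hS
  have h3 : 0 ≤ volume.real B := measureReal_nonneg
  unfold informedDemand
  rw [← hA, ← hB]
  linarith

theorem informedDemand_le_one (z z' p p' : ℝ) : informedDemand z z' p p' ≤ 1 := by
  have := informedDemand_le (z := z) (z' := z') (p := p) (p' := p') (S := Ioo 0 1) (by simp)
    (fun t ht _ _ => ht)
  simpa using this

theorem informedDemand_eq_zero {z z' p p' : ℝ}
    (h : ∀ t ∈ Ioo (0 : ℝ) 1, utility z p t < utility z' p' t) :
    informedDemand z z' p p' = 0 := by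
  refine le_antisymm ?_ (informedDemand_nonneg _ _ _ _)
  have := informedDemand_le (z := z) (z' := z') (p := p) (p' := p') (S := ∅) (by simp)
    (fun t ht _ h' => absurd (h t ht) (not_lt.2 h'))
  simpa using this

theorem informedDemand_eq_of_threshold_left {z z' p p' c : ℝ} (hc : 0 ≤ c) (hc1 : c ≤ 1)
    (h₀ : ∀ t ∈ Ioo (0 : ℝ) 1, 0 ≤ utility z p t)
    (hlt : ∀ t ∈ Ioo (0 : ℝ) 1, t < c → utility z' p' t < utility z p t)
    (hgt : ∀ t ∈ Ioo (0 : ℝ) 1, c < t → utility z p t < utility z' p' t) :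
    informedDemand z z' p p' = c := by
  refine le_antisymm ?_ ?_
  · have := informedDemand_le (z := z) (z' := z') (p := p) (p' := p') (S := Ioc 0 c) (by simp)
      (fun t ht _ h' => ⟨ht.1, not_lt.1 fun h => absurd (hgt t ht h) (not_lt.2 h')⟩)
    simpa [hc] using this
  · unfold informedDemand
    have h1 : volume.real (Ioo 0 c) ≤ volume.real {t : ℝ | t ∈ Ioo (0 : ℝ) 1
        ∧ 0 ≤ utility z p t ∧ utility z' p' t < utility z p t} := by
      refine measureReal_mono (fun t ht => ?_)
        (measure_ne_top_of_subset (fun t ht => ht.1) (measure_Ioo_lt_top (a := (0 : ℝ)) (b := 1)).ne)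
      have ht' : t ∈ Ioo (0 : ℝ) 1 := ⟨ht.1, ht.2.trans_le hc1⟩
      exact ⟨ht', h₀ t ht', hlt t ht' ht.2⟩
    have h2 : volume.real (Ioo 0 c) = c := by simp [hc]
    have h3 : (0 : ℝ) ≤ 1 / 2 * volume.real {t : ℝ | t ∈ Ioo (0 : ℝ) 1
        ∧ 0 ≤ utility z p t ∧ utility z' p' t = utility z p t} := by positivity
    linarith

theorem informedDemand_eq_of_threshold_right {z z' p p' c : ℝ} (hc : 0 ≤ c) (hc1 : c ≤ 1)
    (h₀ : ∀ t ∈ Ioo (0 : ℝ) 1, c < t → 0 ≤ utility z p t)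
    (hlt : ∀ t ∈ Ioo (0 : ℝ) 1, t < c → utility z p t < utility z' p' t)
    (hgt : ∀ t ∈ Ioo (0 : ℝ) 1, c < t → utility z' p' t < utility z p t) :
    informedDemand z z' p p' = 1 - c := by
  refine le_antisymm ?_ ?_
  · have := informedDemand_le (z := z) (z' := z') (p := p) (p' := p') (S := Ico c 1) (by simp)
      (fun t ht _ h' => ⟨not_lt.1 fun h => absurd (hlt t ht h) (not_lt.2 h'), ht.2⟩)
    simpa [hc1] using this
  · unfold informedDemand
    have h1 : volume.real (Ioo c 1) ≤ volume.real {t : ℝ | t ∈ Ioo (0 : ℝ) 1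
        ∧ 0 ≤ utility z p t ∧ utility z' p' t < utility z p t} := by
      refine measureReal_mono (fun t ht => ?_)
        (measure_ne_top_of_subset (fun t ht => ht.1) (measure_Ioo_lt_top (a := (0 : ℝ)) (b := 1)).ne)
      have ht' : t ∈ Ioo (0 : ℝ) 1 := ⟨hc.trans_lt ht.1, ht.2⟩
      exact ⟨ht', h₀ t ht' ht.1, hgt t ht' ht.1⟩
    have h2 : volume.real (Ioo c 1) = 1 - c := by simp [hc1]
    have h3 : (0 : ℝ) ≤ 1 / 2 * volume.real {t : ℝ | t ∈ Ioo (0 : ℝ) 1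
        ∧ 0 ≤ utility z p t ∧ utility z' p' t = utility z p t} := by positivity
    linarith

section

variable {z₁ z₂ p q : ℝ}

theorem utility₁_nonneg (hz₁ : 1 / 2 ≤ z₁) (hp : p ≤ 1 - z₁) {t : ℝ} (ht : t ∈ Ioo (0 : ℝ) 1) :
    0 ≤ utility z₁ p t := by
  have : |t - z₁| ≤ z₁ := abs_le.2 ⟨by linarith [ht.1], by linarith [ht.2]⟩
  unfold utility
  linarith

theorem informedDemand₁_eq_one (hz₁ : 1 / 2 ≤ z₁) (hz : z₁ < z₂)
    (hp : p ≤ 1 - z₁) (hpq : p + (z₂ - z₁) < q) : informedDemand z₁ z₂ p q = 1 := by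
  refine informedDemand_eq_of_threshold_left zero_le_one le_rfl
    (fun t ht => utility₁_nonneg hz₁ hp ht) (fun t ht _ => ?_) (fun t ht h => by linarith [ht.2])
  unfold utility
  have := abs_sub_abs_le_abs_sub (t - z₁) (t - z₂)
  have h2 : |t - z₁ - (t - z₂)| = z₂ - z₁ := by rw [abs_of_nonneg] <;> linarith
  linarith

theorem informedDemand₁_eq (hz₁ : 1 / 2 ≤ z₁) (hz : z₁ < z₂) (hz₂ : z₂ ≤ 1)
    (hp : p ≤ 1 - z₁) (hpq : q < p + (z₂ - z₁)) (hqp : p < q + (z₂ - z₁)) :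
    informedDemand z₁ z₂ p q = (z₁ + z₂ + q - p) / 2 := by
  refine informedDemand_eq_of_threshold_left (by linarith) (by linarith)
    (fun t ht => utility₁_nonneg hz₁ hp ht) (fun t ht h => ?_) (fun t ht h => ?_)
  all_goals
    unfold utility
    rcases abs_cases (t - z₁) with h1 | h1 <;> rcases abs_cases (t - z₂) with h2 | h2 <;> linarith

theorem informedDemand₂_eq (hz₁ : 1 / 2 ≤ z₁) (hz : z₁ < z₂) (hz₂ : z₂ ≤ 1)
    (hp : p ≤ 1 - z₁) (hpq : q < p + (z₂ - z₁)) (hqp : p < q + (z₂ - z₁)) :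
    informedDemand z₂ z₁ q p = 1 - (z₁ + z₂ + q - p) / 2 := by
  have hgt : ∀ t ∈ Ioo (0 : ℝ) 1, (z₁ + z₂ + q - p) / 2 < t →
      utility z₁ p t < utility z₂ q t := by
    intro t ht h
    unfold utility
    rcases abs_cases (t - z₁) with h1 | h1 <;> rcases abs_cases (t - z₂) with h2 | h2 <;> linarith
  have hlt : ∀ t ∈ Ioo (0 : ℝ) 1, t < (z₁ + z₂ + q - p) / 2 →
      utility z₂ q t < utility z₁ p t := by
    intro t ht h
    unfold utility
    rcases abs_cases (t - z₁) with h1 | h1 <;> rcases abs_cases (t - z₂) with h2 | h2 <;> linarith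
  refine informedDemand_eq_of_threshold_right (by linarith) (by linarith)
    (fun t ht h => (utility₁_nonneg hz₁ hp ht).trans (hgt t ht h).le) hlt hgt

theorem informedDemand₂_eq_zero (hz : z₁ < z₂) (hpq : p + (z₂ - z₁) < q) :
    informedDemand z₂ z₁ q p = 0 := by
  refine informedDemand_eq_zero fun t _ => ?_
  unfold utility
  have := abs_sub_abs_le_abs_sub (t - z₁) (t - z₂)
  have h2 : |t - z₁ - (t - z₂)| = z₂ - z₁ := by rw [abs_of_nonneg] <;> linarith
  linarith

/-- Meant for the tie `q = p + δ`, where `1 - z₂` is the value of the affine demand formula. -/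
theorem informedDemand₂_le (hz : z₁ < z₂) (hz₂ : z₂ ≤ 1) (hpq : p + (z₂ - z₁) ≤ q) :
    informedDemand z₂ z₁ q p ≤ 1 - z₂ := by
  have := informedDemand_le (z := z₂) (z' := z₁) (p := q) (p' := p) (S := Icc z₂ 1) (by simp)
    (fun t ht _ h => ?_)
  · simpa [hz₂] using this
  · refine ⟨?_, ht.2.le⟩
    unfold utility at h
    rcases abs_cases (t - z₁) with h1 | h1 <;> rcases abs_cases (t - z₂) with h2 | h2 <;> linarith

/-- A firm that loses its captive buyers cannot earn more than `2 z (1 - z)`. -/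
theorem mul_informedDemand₁_le (hz₁ : 1 / 2 ≤ z₁) (hz₁' : z₁ ≤ 2 / 3) (hp : 1 - z₁ < p) (q : ℝ) :
    p * informedDemand z₁ z₂ p q ≤ 2 * z₁ * (1 - z₁) := by
  have hp0 : 0 < p := by linarith
  -- Up to `z₁` the bound is `p (2 - z₁ - p)`, increasing there because `z₁ ≤ 2/3`; beyond `z₁` it
  -- is `2 p (1 - p)`, decreasing because `z₁ ≥ 1/2`. Both peak at `p = z₁`.
  rcases le_total p z₁ with h | h
  · have := informedDemand_le (z := z₁) (z' := z₂) (p := p) (p' := q)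
      (S := Icc (z₁ - (1 - p)) 1) (by simp) (fun t ht h0 _ => ?_)
    · rw [Real.volume_real_Icc_of_le (by linarith)] at this
      nlinarith
    · refine ⟨?_, ht.2.le⟩
      unfold utility at h0
      linarith [neg_abs_le (t - z₁)]
  · rcases le_total p 1 with h' | h'
    · have := informedDemand_le (z := z₁) (z' := z₂) (p := p) (p' := q)
        (S := Icc (z₁ - (1 - p)) (z₁ + (1 - p))) (by simp) (fun t ht h0 _ => ?_)
      · rw [Real.volume_real_Icc_of_le (by linarith)] at this
        nlinarith
      · unfold utility at h0
        constructor
        · linarith [neg_abs_le (t - z₁)]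
        · linarith [le_abs_self (t - z₁)]
    · have := informedDemand_le (z := z₁) (z' := z₂) (p := p) (p' := q)
        (S := {z₁}) (by simp) (fun t ht h0 _ => ?_)
      · have h2 : informedDemand z₁ z₂ p q ≤ 0 := by simpa [measureReal_def] using this
        nlinarith
      · unfold utility at h0
        have : |t - z₁| = 0 := le_antisymm (by linarith) (abs_nonneg _)
        exact mem_singleton_iff.2 (by linarith [abs_eq_zero.1 this])

end


/-! ### Comparison lemmas, and the candidate distributions with densities and primitives. -/

theorem monotoneOn_Icc_of_hasDerivAt {F f : ℝ → ℝ} {l r : ℝ}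
    (hF : ∀ t ∈ Icc l r, HasDerivAt F (f t) t) (hf : ∀ t ∈ Icc l r, 0 ≤ f t) :
    MonotoneOn F (Icc l r) := by
  refine monotoneOn_of_hasDerivWithinAt_nonneg (f' := f) (convex_Icc l r)
    (fun t ht => (hF t ht).continuousAt.continuousWithinAt)
    (fun t ht => (hF t (interior_subset ht)).hasDerivWithinAt)
    (fun t ht => hf t (interior_subset ht))

theorem sub_le_mul_sub_of_hasDerivAt {F f : ℝ → ℝ} {l r C x y : ℝ}
    (hF : ∀ t ∈ Icc l r, HasDerivAt F (f t) t) (hf : ∀ t ∈ Icc l r, f t ≤ C)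
    (hx : x ∈ Icc l r) (hy : y ∈ Icc l r) (hxy : x ≤ y) : F y - F x ≤ C * (y - x) := by
  have := monotoneOn_Icc_of_hasDerivAt (F := fun t => C * t - F t) (f := fun t => C * 1 - f t)
    (fun t ht => ((hasDerivAt_id t).const_mul C).sub (hF t ht))
    (fun t ht => by linarith [hf t ht]) hx hy hxy
  simp only at this
  linarith

/-- A function whose derivative is `k f - e` with `e ≥ 0` is nonnegative on an interval
as soon as it is nonnegative at the right end. -/
theorem nonneg_of_hasDerivAt_mul_sub {f e : ℝ → ℝ} {l r k : ℝ}
    (hf : ∀ t ∈ Icc l r, HasDerivAt f (k * f t - e t) t) (he : ∀ t ∈ Icc l r, 0 ≤ e t)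
    (hr : 0 ≤ f r) {t : ℝ} (ht : t ∈ Icc l r) : 0 ≤ f t := by
  have hE : ∀ t, HasDerivAt (fun s => Real.exp (-k * s)) (Real.exp (-k * t) * (-k * 1)) t :=
    fun t => ((hasDerivAt_id t).const_mul (-k)).exp
  have h1 := monotoneOn_Icc_of_hasDerivAt (F := fun t => -(f t * Real.exp (-k * t)))
    (f := fun t => e t * Real.exp (-k * t)) (l := l) (r := r)
    (fun t ht => ((hf t ht).mul (hE t)).neg.congr_deriv (by ring))
    (fun t ht => mul_nonneg (he t ht) (Real.exp_pos _).le) ht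
    (right_mem_Icc.2 (ht.1.trans ht.2)) ht.2
  have h2 : 0 ≤ f r * Real.exp (-k * r) := mul_nonneg hr (Real.exp_pos _).le
  have h3 : 0 ≤ f t * Real.exp (-k * t) := by
    simp only at h1
    linarith
  exact nonneg_of_mul_nonneg_left h3 (Real.exp_pos _)

/-- The distribution function of Firm 1 below its atom. -/
def cdf₁ (z₁ z₂ t : ℝ) : ℝ := g z₁ z₂ t (1 - z₁) z₂

/-- The derivative of `cdf₁`. -/
def dens₁ (z₁ z₂ t : ℝ) : ℝ :=
  lam₂ z₂ * (cdf₁ z₁ z₂ t - 1) + 2 * lam₂ z₂ * z₂ / (t + (z₂ - z₁)) ^ 2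

/-- A primitive of `cdf₁`. -/
def prim₁ (z₁ z₂ t : ℝ) : ℝ :=
  cdf₁ z₁ z₂ t * (2 * (1 - z₂)) + t + 2 * z₂ / (t + (z₂ - z₁))

/-- The distribution function of Firm 2 below its atom. -/
def cdf₂ (z₁ z₂ w r : ℝ) : ℝ := h z₁ z₂ r (1 - 2 * z₁ + z₂ - w)

/-- The derivative of `cdf₂`. -/
def dens₂ (z₁ z₂ w r : ℝ) : ℝ :=
  lam₂ z₂ * (4 * (1 - z₁ - w) / (r - (z₂ - z₁)) ^ 2 - cdf₂ z₁ z₂ w r)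

/-- A primitive of `cdf₂`. -/
def prim₂ (z₁ z₂ w r : ℝ) : ℝ :=
  -(4 * (1 - z₁ - w) / (r - (z₂ - z₁))) - cdf₂ z₁ z₂ w r * (2 * (1 - z₂))

theorem lam₂_pos {z₂ : ℝ} (hz₂ : z₂ < 1) : 0 < lam₂ z₂ := by
  unfold lam₂; apply one_div_pos.2; linarith

theorem lam₂_mul {z₂ : ℝ} (hz₂ : z₂ < 1) : lam₂ z₂ * (2 * (1 - z₂)) = 1 := by
  unfold lam₂
  have : 1 - z₂ ≠ 0 := by linarith
  field_simp

section

variable {z₁ z₂ w t : ℝ}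

theorem hasDerivAt_cdf₁ (hz₂ : z₂ < 1) (ht : 0 < t + (z₂ - z₁)) :
    HasDerivAt (cdf₁ z₁ z₂) (dens₁ z₁ z₂ t) t :=
  hasDerivAt_g hz₂ ht

theorem hasDerivAt_const_div_add {k d : ℝ} (ht : 0 < t + d) :
    HasDerivAt (fun s => k / (s + d)) (-(k / (t + d) ^ 2)) t :=
  ((hasDerivAt_const t k).div ((hasDerivAt_id t).add_const d) ht.ne').congr_deriv (by simp; ring)

theorem hasDerivAt_const_div_add_sq {k d : ℝ} (ht : 0 < t + d) :
    HasDerivAt (fun s => k / (s + d) ^ 2) (-(2 * k / (t + d) ^ 3)) t :=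
  ((hasDerivAt_const t k).div (((hasDerivAt_id t).add_const d).pow 2)
    (pow_ne_zero 2 ht.ne')).congr_deriv (by simp only [id]; field_simp; norm_num; ring)

theorem hasDerivAt_prim₁ (hz₂ : z₂ < 1) (ht : 0 < t + (z₂ - z₁)) :
    HasDerivAt (prim₁ z₁ z₂) (cdf₁ z₁ z₂ t) t := by
  refine ((((hasDerivAt_cdf₁ hz₂ ht).mul_const (2 * (1 - z₂))).add (hasDerivAt_id t)).add
    (hasDerivAt_const_div_add ht)).congr_deriv ?_
  have hl := lam₂_mul hz₂
  unfold dens₁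
  generalize cdf₁ z₁ z₂ t = F
  linear_combination (F - 1 + 2 * z₂ / (t + (z₂ - z₁)) ^ 2) * hl

theorem hasDerivAt_dens₁ (hz₂ : z₂ < 1) (ht : 0 < t + (z₂ - z₁)) :
    HasDerivAt (dens₁ z₁ z₂)
      (lam₂ z₂ * dens₁ z₁ z₂ t - 2 * (2 * lam₂ z₂ * z₂) / (t + (z₂ - z₁)) ^ 3) t := by
  refine ((((hasDerivAt_cdf₁ hz₂ ht).sub_const 1).const_mul (lam₂ z₂)).add
    (hasDerivAt_const_div_add_sq ht)).congr_deriv ?_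
  ring

theorem hasDerivAt_cdf₂ (hz₂ : z₂ < 1) (ht : 0 < t - (z₂ - z₁)) :
    HasDerivAt (cdf₂ z₁ z₂ w) (dens₂ z₁ z₂ w t) t := by
  have := hasDerivAt_h (a := 1 - 2 * z₁ + z₂ - w) hz₂ ht
  have e : 1 - 2 * z₁ + z₂ - w - (z₂ - z₁) = 1 - z₁ - w := by ring
  rw [e] at this
  exact this

theorem hasDerivAt_prim₂ (hz₂ : z₂ < 1) (ht : 0 < t - (z₂ - z₁)) :
    HasDerivAt (prim₂ z₁ z₂ w) (cdf₂ z₁ z₂ w t) t := by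
  have ht' : 0 < t + -(z₂ - z₁) := by linarith
  refine ((hasDerivAt_const_div_add (k := 4 * (1 - z₁ - w)) ht').neg.sub
    ((hasDerivAt_cdf₂ hz₂ ht).mul_const (2 * (1 - z₂)))).congr_deriv ?_
  have hl := lam₂_mul hz₂
  unfold dens₂
  generalize cdf₂ z₁ z₂ w t = F
  rw [← sub_eq_add_neg]
  linear_combination (-(4 * (1 - z₁ - w) / (t - (z₂ - z₁)) ^ 2) + F) * hl

theorem hasDerivAt_dens₂ (hz₂ : z₂ < 1) (ht : 0 < t - (z₂ - z₁)) :
    HasDerivAt (dens₂ z₁ z₂ w)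
      (-lam₂ z₂ * dens₂ z₁ z₂ w t
        - lam₂ z₂ * (2 * (4 * (1 - z₁ - w)) / (t - (z₂ - z₁)) ^ 3)) t := by
  have ht' : 0 < t + -(z₂ - z₁) := by linarith
  refine (((hasDerivAt_const_div_add_sq (k := 4 * (1 - z₁ - w)) ht').sub
    (hasDerivAt_cdf₂ hz₂ ht)).const_mul (lam₂ z₂)).congr_deriv ?_
  rw [← sub_eq_add_neg]
  ring

theorem cdf₁_right (hz₂ : z₂ < 1) :
    cdf₁ z₁ z₂ (1 - z₁) = 1 - (z₂ / (1 - 2 * z₁ + z₂) - 1) / (1 - z₂) := g_right hz₂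

theorem cdf₂_left (hw : w < 1 - z₁) : cdf₂ z₁ z₂ w (1 - 2 * z₁ + z₂ - w) = 0 :=
  h_left (by linarith)

end

/-! ### Inequalities for admissible parameters. -/

/-- Parameters for which the candidate distributions form an equilibrium. -/
structure Admissible (z₁ z₂ w : ℝ) : Prop where
  half_le : 1 / 2 ≤ z₁
  lt : z₁ < z₂
  lt_one : z₂ < 1
  region : z₂ < (1 - 2 * z₁ + z₂) * (2 - z₂)
  pos : 0 < w
  lt_price : w < 1 - z₁
  root : cdf₁ z₁ z₂ (1 - z₁ - w) = 0
  cdf₂_le : cdf₂ z₁ z₂ w (1 - 2 * z₁ + z₂) ≤ 1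
  undercut : 0 ≤ (z₂ - z₁) * z₂ + 2 * z₁ + (1 - z₂) * w / 2 - z₁ * z₂ / (1 - 2 * z₁ + z₂)
    - (1 - z₂) * z₂ / (1 - 2 * z₁ + z₂ - w)

namespace Admissible

variable {z₁ z₂ w : ℝ} (A : Admissible z₁ z₂ w)
include A

theorem le_two_thirds : z₁ ≤ 2 / 3 := by
  by_contra! h
  nlinarith [A.region, A.lt, A.lt_one, sq_nonneg (z₂ - 2 / 3), A.half_le]

theorem cdf₁_right_mul :
    (1 - z₂) * cdf₁ z₁ z₂ (1 - z₁) = 2 - z₂ - z₂ / (1 - 2 * z₁ + z₂) := by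
  rw [cdf₁_right A.lt_one]
  have := A.lt_one
  have : 1 - z₂ ≠ 0 := by linarith
  field_simp
  ring

theorem one_le_ratio : 1 ≤ z₂ / (1 - 2 * z₁ + z₂) := by
  rw [le_div_iff₀] <;> linarith [A.lt, A.lt_one, A.half_le]

/-- This is what the region condition encodes: Firm 1's atom at its top price has mass below one. -/
theorem cdf₁_right_pos : 0 < cdf₁ z₁ z₂ (1 - z₁) := by
  have h1 := A.cdf₁_right_mul
  have h2 : z₂ / (1 - 2 * z₁ + z₂) < 2 - z₂ := by
    rw [div_lt_iff₀] <;> linarith [A.lt, A.lt_one, A.half_le, A.region]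
  have h3 := A.lt_one
  by_contra! h
  nlinarith

theorem cdf₁_right_le_one : cdf₁ z₁ z₂ (1 - z₁) ≤ 1 := by
  have h1 := A.cdf₁_right_mul
  have h2 := A.one_le_ratio
  have h3 := A.lt_one
  by_contra! h
  nlinarith

theorem add_pos_of_mem {t : ℝ} (ht : t ∈ Icc (1 - z₁ - w) (1 - z₁)) : 0 < t + (z₂ - z₁) := by
  linarith [ht.1, A.lt_price, A.lt]

theorem sub_pos_of_mem {t : ℝ} (ht : t ∈ Icc (1 - 2 * z₁ + z₂ - w) (1 - 2 * z₁ + z₂)) :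
    0 < t - (z₂ - z₁) := by
  linarith [ht.1, A.lt_price]

theorem left_mem : 1 - z₁ - w ∈ Icc (1 - z₁ - w) (1 - z₁) :=
  left_mem_Icc.2 (by linarith [A.pos])

theorem right_mem : 1 - z₁ ∈ Icc (1 - z₁ - w) (1 - z₁) :=
  right_mem_Icc.2 (by linarith [A.pos])

theorem left_mem₂ : 1 - 2 * z₁ + z₂ - w ∈ Icc (1 - 2 * z₁ + z₂ - w) (1 - 2 * z₁ + z₂) :=
  left_mem_Icc.2 (by linarith [A.pos])

theorem right_mem₂ : 1 - 2 * z₁ + z₂ ∈ Icc (1 - 2 * z₁ + z₂ - w) (1 - 2 * z₁ + z₂) :=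
  right_mem_Icc.2 (by linarith [A.pos])

theorem dens₁_right_nonneg : 0 ≤ dens₁ z₁ z₂ (1 - z₁) := by
  have h1 := A.cdf₁_right_pos
  have h2 := A.one_le_ratio
  have e : 1 - z₁ + (z₂ - z₁) = 1 - 2 * z₁ + z₂ := by ring
  have hp : 0 < 1 - 2 * z₁ + z₂ := by linarith [A.lt, A.lt_one]
  have h3 : 1 ≤ z₂ / (1 - 2 * z₁ + z₂) ^ 2 := by
    rw [le_div_iff₀ (by positivity)]
    nlinarith [A.lt, A.lt_one, A.half_le]
  have h4 : dens₁ z₁ z₂ (1 - z₁)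
      = lam₂ z₂ * (cdf₁ z₁ z₂ (1 - z₁) - 1 + 2 * (z₂ / (1 - 2 * z₁ + z₂) ^ 2)) := by
    unfold dens₁
    rw [e]
    ring
  rw [h4]
  exact mul_nonneg (lam₂_pos A.lt_one).le (by linarith)

theorem dens₁_nonneg : ∀ t ∈ Icc (1 - z₁ - w) (1 - z₁), 0 ≤ dens₁ z₁ z₂ t := fun t ht =>
  nonneg_of_hasDerivAt_mul_sub (k := lam₂ z₂)
    (fun s hs => hasDerivAt_dens₁ A.lt_one (A.add_pos_of_mem hs))
    (fun s hs => by
      have := A.add_pos_of_mem hs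
      have := lam₂_pos A.lt_one
      have : 0 < z₂ := by linarith [A.lt, A.half_le]
      positivity)
    A.dens₁_right_nonneg ht

theorem monotoneOn_cdf₁ : MonotoneOn (cdf₁ z₁ z₂) (Icc (1 - z₁ - w) (1 - z₁)) :=
  monotoneOn_Icc_of_hasDerivAt (fun _ ht => hasDerivAt_cdf₁ A.lt_one (A.add_pos_of_mem ht))
    A.dens₁_nonneg

theorem cdf₁_nonneg {t : ℝ} (ht : t ∈ Icc (1 - z₁ - w) (1 - z₁)) : 0 ≤ cdf₁ z₁ z₂ t :=
  A.root ▸ A.monotoneOn_cdf₁ A.left_mem ht ht.1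

theorem cdf₁_le {t : ℝ} (ht : t ∈ Icc (1 - z₁ - w) (1 - z₁)) :
    cdf₁ z₁ z₂ t ≤ cdf₁ z₁ z₂ (1 - z₁) :=
  A.monotoneOn_cdf₁ ht A.right_mem ht.2

theorem prim₁_le_of_le {x y : ℝ} (hx : x ∈ Icc (1 - z₁ - w) (1 - z₁))
    (hy : y ∈ Icc (1 - z₁ - w) (1 - z₁)) (hxy : x ≤ y) : prim₁ z₁ z₂ x ≤ prim₁ z₁ z₂ y :=
  monotoneOn_Icc_of_hasDerivAt (fun _ ht => hasDerivAt_prim₁ A.lt_one (A.add_pos_of_mem ht))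
    (fun _ ht => A.cdf₁_nonneg ht) hx hy hxy

theorem prim₁_right_sub_le {x : ℝ} (hx : x ∈ Icc (1 - z₁ - w) (1 - z₁)) :
    prim₁ z₁ z₂ (1 - z₁) - prim₁ z₁ z₂ x ≤ cdf₁ z₁ z₂ (1 - z₁) * (1 - z₁ - x) :=
  sub_le_mul_sub_of_hasDerivAt (fun _ ht => hasDerivAt_prim₁ A.lt_one (A.add_pos_of_mem ht))
    (fun _ ht => A.cdf₁_le ht) hx A.right_mem hx.2

theorem prim₁_left : prim₁ z₁ z₂ (1 - z₁ - w)
    = 1 - z₁ - w + 2 * (z₂ / (1 - 2 * z₁ + z₂ - w)) := by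
  unfold prim₁
  rw [A.root, show 1 - z₁ - w + (z₂ - z₁) = 1 - 2 * z₁ + z₂ - w by ring]
  ring

theorem prim₁_right : prim₁ z₁ z₂ (1 - z₁) = 1 - z₁ + 2 * (2 - z₂) := by
  unfold prim₁
  have := A.cdf₁_right_mul
  rw [show 1 - z₁ + (z₂ - z₁) = 1 - 2 * z₁ + z₂ by ring]
  linear_combination 2 * this

/-- At its lowest price Firm 2 earns `z₂` on average, hence at most what it would earn if Firm 1
always charged `1 - z₁`. Formally, `prim₁` increases. -/
theorem le_mul_lowest : z₂ ≤ (1 - 2 * z₁ + z₂ - w) * (2 - z₂ + w / 2) := by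
  have h1 := A.prim₁_le_of_le A.left_mem A.right_mem (by linarith [A.pos])
  rw [A.prim₁_left, A.prim₁_right] at h1
  have hp : 0 < 1 - 2 * z₁ + z₂ - w := by linarith [A.lt, A.lt_price]
  have h2 : z₂ / (1 - 2 * z₁ + z₂ - w) ≤ 2 - z₂ + w / 2 := by linarith
  rw [div_le_iff₀ hp] at h2
  linarith

theorem sq_le_four_mul : (1 - z₁) ^ 2 ≤ 4 * (1 - z₁ - w) := by
  have h1 := A.le_mul_lowest
  have h2 := A.half_le
  have h3 := A.lt
  have h4 := A.lt_one
  by_contra! h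
  -- The worst case is `z₁ = 1/2`, where `-z₁ + (1 - z₁)² / 4 = -7/16`. The resulting quadratic
  -- inequality in `z₂` is centred at `27/32` and has no real solution.
  have h5 : 1 - 2 * z₁ + z₂ - w ≤ z₂ - 7 / 16 := by nlinarith
  have h6 : 2 - z₂ + w / 2 ≤ 9 / 4 - z₂ := by linarith [A.lt_price]
  nlinarith [mul_le_mul h5 h6 (by linarith [A.pos]) (by linarith), sq_nonneg (z₂ - 27 / 32)]

theorem dens₂_right_nonneg : 0 ≤ dens₂ z₁ z₂ w (1 - 2 * z₁ + z₂) := by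
  unfold dens₂
  have h1 := A.cdf₂_le
  have h2 := A.sq_le_four_mul
  have h3 : 0 < 1 - z₁ := by linarith [A.lt, A.lt_one]
  rw [show 1 - 2 * z₁ + z₂ - (z₂ - z₁) = 1 - z₁ by ring]
  have h4 : 1 ≤ 4 * (1 - z₁ - w) / (1 - z₁) ^ 2 := by
    rw [le_div_iff₀ (by positivity)]
    linarith
  exact mul_nonneg (lam₂_pos A.lt_one).le (by linarith)

theorem dens₂_nonneg :
    ∀ t ∈ Icc (1 - 2 * z₁ + z₂ - w) (1 - 2 * z₁ + z₂), 0 ≤ dens₂ z₁ z₂ w t := fun t ht =>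
  nonneg_of_hasDerivAt_mul_sub (k := -lam₂ z₂)
    (fun s hs => hasDerivAt_dens₂ A.lt_one (A.sub_pos_of_mem hs))
    (fun s hs => by
      have := A.sub_pos_of_mem hs
      have := lam₂_pos A.lt_one
      have : 0 < 1 - z₁ - w := by linarith [A.lt_price]
      positivity)
    A.dens₂_right_nonneg ht

theorem cdf₂_le_one {t : ℝ} (ht : t ∈ Icc (1 - 2 * z₁ + z₂ - w) (1 - 2 * z₁ + z₂)) :
    cdf₂ z₁ z₂ w t ≤ 1 :=
  (monotoneOn_Icc_of_hasDerivAt (fun _ ht => hasDerivAt_cdf₂ A.lt_one (A.sub_pos_of_mem ht))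
    A.dens₂_nonneg ht A.right_mem₂ ht.2).trans A.cdf₂_le

theorem prim₂_left : prim₂ z₁ z₂ w (1 - 2 * z₁ + z₂ - w) = -4 := by
  unfold prim₂
  rw [cdf₂_left A.lt_price, show 1 - 2 * z₁ + z₂ - w - (z₂ - z₁) = 1 - z₁ - w by ring,
    mul_div_assoc, div_self (by linarith [A.lt_price])]
  ring

/-- The integral of Firm 2's distribution function over its interval is at most the width `w`; the
primitive makes this explicit. -/
theorem width_mul_le : w * (3 + z₁) ≤ 2 * (1 - z₂) * (1 - z₁) := by
  have h1 := sub_le_mul_sub_of_hasDerivAt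
    (fun _ ht => hasDerivAt_prim₂ A.lt_one (A.sub_pos_of_mem ht))
    (fun _ ht => A.cdf₂_le_one ht) A.left_mem₂ A.right_mem₂ A.left_mem₂.2
  have h2 := A.cdf₂_le
  have hb : 0 < 1 - z₁ := by linarith [A.lt, A.lt_one]
  rw [A.prim₂_left] at h1
  unfold prim₂ at h1
  rw [show 1 - 2 * z₁ + z₂ - (z₂ - z₁) = 1 - z₁ by ring] at h1
  have h3 : 4 - w - 2 * (1 - z₂) ≤ 4 * (1 - z₁ - w) / (1 - z₁) := by
    nlinarith [A.lt_one]
  rw [le_div_iff₀ hb] at h3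
  nlinarith

/-- Condition `undercut` in terms of the distribution of Firm 1. -/
theorem undercut_profit_le : (1 - z₂) * (2 - z₁ * cdf₁ z₁ z₂ (1 - z₁)
    - (prim₁ z₁ z₂ (1 - z₁) - prim₁ z₁ z₂ (1 - z₁ - w)) / 2) ≤ z₂ := by
  have h1 := A.undercut
  have h2 := A.cdf₁_right_mul
  rw [A.prim₁_left, A.prim₁_right]
  simp only [mul_div_assoc] at h1
  linear_combination h1 - z₁ * h2

/-- Otherwise `z₂ - z₁` is at most `(1 - z₂) / 7`, and the locations are so close that undercutting
Firm 1's atom would earn Firm 2 more than `z₂`. -/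
theorem width_lt : w < 2 * (z₂ - z₁) := by
  have h1 := A.undercut_profit_le
  have h2 := A.cdf₁_right_mul
  have h3 := A.prim₁_right_sub_le A.left_mem
  have h4 := A.width_mul_le
  have h5 := A.lt_one
  have h6 := A.half_le
  have h7 := A.lt
  have h8 := A.cdf₁_right_pos
  have hp : 0 < 1 - 2 * z₁ + z₂ := by linarith
  by_contra! hw
  -- The constant comes from `(1 - z₁) / (3 + z₁) ≤ 1/7` for `z₁ ≥ 1/2`.
  have h9 : w ≤ 2 * (1 - z₂) / 7 := by nlinarith [A.pos]
  have h10 : (1 - z₂) * (2 - (z₁ + (1 - z₂) / 7) * cdf₁ z₁ z₂ (1 - z₁)) ≤ z₂ := by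
    refine le_trans (mul_le_mul_of_nonneg_left ?_ (by linarith)) h1
    nlinarith
  have h11 : 2 * (1 - z₂) - (z₁ + (1 - z₂) / 7) * (2 - z₂ - z₂ / (1 - 2 * z₁ + z₂)) ≤ z₂ := by
    rw [← h2]; linarith
  have h12 : (2 * (1 - z₂) - z₂ - (z₁ + (1 - z₂) / 7) * (2 - z₂)) * (1 - 2 * z₁ + z₂)
      + (z₁ + (1 - z₂) / 7) * z₂ ≤ 0 := by
    have : z₂ / (1 - 2 * z₁ + z₂) * (1 - 2 * z₁ + z₂) = z₂ := div_mul_cancel₀ _ hp.ne'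
    nlinarith
  obtain ⟨u, rfl⟩ : ∃ u, z₂ = 1 - u := ⟨1 - z₂, by ring⟩
  obtain ⟨d, rfl⟩ : ∃ d, z₁ = 1 - u - d := ⟨1 - u - z₁, by ring⟩
  have hd : 0 < d := by linarith
  have hdu : d ≤ u / 7 := by linarith
  have hu : u ≤ 1 / 2 := by linarith
  have hu0 : 0 < u := by linarith
  -- Expansion of the left side of `h12` in `u / 7 - d`: `e1` concerns the linear coefficient, `2 (1
  -- + u)` is the quadratic one, and the cubic in `e3` is seven times the value at `d = u / 7`. That
  -- cubic has its minimum on `[0, 1/2]` near `41/100`.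
  have e1 : 0 ≤ 5 - 58 / 7 * u - 23 / 7 * u ^ 2 := by nlinarith
  have e2 : 0 ≤ (u / 7 - d) * (5 - 58 / 7 * u - 23 / 7 * u ^ 2 + (u / 7 - d) * (2 * (1 + u))) :=
    mul_nonneg (by linarith) (add_nonneg e1 (mul_nonneg (by linarith) (by linarith)))
  have e3 : 0 < 9 * u ^ 3 + 34 * u ^ 2 - 32 * u + 7 := by
    nlinarith [mul_nonneg hu0.le (sq_nonneg (u - 41 / 100)), sq_nonneg (u - 41 / 100)]
  nlinarith

/-- Equivalent to `2 z₁ (1 - z₁) ≤ 2 (1 - z₁ - w)`: Firm 1 does not gain by abandoning its captives.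
-/
theorem width_le_sq : w ≤ (1 - z₁) ^ 2 := by
  have h1 := A.width_mul_le
  have h2 : (1 - z₂) * (1 - z₁) ≤ (1 - z₁) ^ 2 := by nlinarith [A.lt, A.lt_one]
  nlinarith [A.half_le, A.pos]

/-- Firm 2's expected profit from undercutting only the prices of Firm 1 above `x`. -/
theorem undercut_le {x : ℝ} (hx : x ∈ Icc (1 - z₁ - w) (1 - z₁)) (hx0 : z₂ - z₁ ≤ x) :
    (x - (z₂ - z₁)) * (2 - z₁ * cdf₁ z₁ z₂ x
      - (prim₁ z₁ z₂ x - prim₁ z₁ z₂ (1 - z₁ - w)) / 2) ≤ z₂ := by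
  refine le_trans ?_ A.undercut_profit_le
  have hE0 := A.cdf₁_right_pos
  have hE1 := A.cdf₁_right_le_one
  have hE := A.cdf₁_right_mul
  have hp := A.add_pos_of_mem hx
  have h7 := A.lt
  have hu := A.lt_one
  have hz := A.half_le
  have hb : 0 < 1 - 2 * z₁ + z₂ := by linarith
  have hΦ := A.prim₁_right_sub_le hx
  have hΦl := A.prim₁_right_sub_le A.left_mem
  have hFx : prim₁ z₁ z₂ x
      = cdf₁ z₁ z₂ x * (2 * (1 - z₂)) + x + 2 * (z₂ / (x + (z₂ - z₁))) := by
    unfold prim₁; ring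
  have hFb := A.prim₁_right
  have hw := A.lt_price
  have hx1 := hx.2
  generalize prim₁ z₁ z₂ x = P at *
  generalize prim₁ z₁ z₂ (1 - z₁) = Q at *
  generalize prim₁ z₁ z₂ (1 - z₁ - w) = R at *
  generalize cdf₁ z₁ z₂ x = F at *
  generalize cdf₁ z₁ z₂ (1 - z₁) = E at *
  -- Firm 2's price is now `1 - z₂ - m`. Lowering it by `m` loses a multiple of `m` on current sales
  -- and gains through `E - F` and `Q - P`; bounding both gains linearly in `m` leaves the single
  -- inequality `hfin`.
  obtain ⟨m, rfl⟩ : ∃ m, x = 1 - z₁ - m := ⟨1 - z₁ - x, by ring⟩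
  have hm : 0 ≤ m := by linarith
  have hk : 0 ≤ 1 - z₂ - m := by linarith
  have hratio : (1 - z₂ - m) * (z₂ / (1 - z₁ - m + (z₂ - z₁)) - z₂ / (1 - 2 * z₁ + z₂))
      ≤ m * ((1 - z₂) * (z₂ / (1 - 2 * z₁ + z₂) ^ 2)) := by
    have e : (1 - z₂ - m) * (z₂ / (1 - z₁ - m + (z₂ - z₁)) - z₂ / (1 - 2 * z₁ + z₂))
        = m * z₂ / (1 - 2 * z₁ + z₂) * ((1 - z₂ - m) / (1 - z₁ - m + (z₂ - z₁))) := by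
      rw [div_sub_div _ _ hp.ne' hb.ne', div_mul_div_comm, mul_div_assoc', mul_comm _ (1 - 2 * z₁ + z₂)]
      congr 1 <;> ring
    have e' : m * ((1 - z₂) * (z₂ / (1 - 2 * z₁ + z₂) ^ 2))
        = m * z₂ / (1 - 2 * z₁ + z₂) * ((1 - z₂) / (1 - 2 * z₁ + z₂)) := by
      field_simp
    rw [e, e']
    refine mul_le_mul_of_nonneg_left ?_ (div_nonneg (mul_nonneg hm (by linarith)) hb.le)
    rw [div_le_div_iff₀ hp hb]
    nlinarith
  have hlast : z₁ * (z₂ / (1 - 2 * z₁ + z₂) ^ 2) ≤ 2 - E := by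
    rw [← mul_div_assoc, div_le_iff₀ (by positivity)]
    have e : (1 - z₂) * ((2 - E) * (1 - 2 * z₁ + z₂) ^ 2)
        = (1 - z₂) * (1 - 2 * z₁ + z₂) ^ 2 + (2 * z₁ - 1) * (1 - 2 * z₁ + z₂) := by
      have : z₂ / (1 - 2 * z₁ + z₂) * (1 - 2 * z₁ + z₂) = z₂ := div_mul_cancel₀ _ hb.ne'
      linear_combination -(1 - 2 * z₁ + z₂) ^ 2 * hE + (1 - 2 * z₁ + z₂) * this
    refine le_of_mul_le_mul_left ?_ (sub_pos.2 hu)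
    rw [e]
    have : 0 ≤ (z₂ - z₁) * z₂ * (4 * z₁ - 1 - z₂) :=
      mul_nonneg (mul_nonneg (by linarith) (by linarith)) (by linarith)
    linarith
  have hEF : (1 - z₂ - m) * (E - F) ≤ m * (z₂ / (1 - 2 * z₁ + z₂) ^ 2) := by
    have e : 2 * (1 - z₂) * (E - F) = (Q - P) - m
        + 2 * (z₂ / (1 - z₁ - m + (z₂ - z₁)) - z₂ / (1 - 2 * z₁ + z₂)) := by
      linear_combination 2 * hE + hFx - hFb
    have e1 : (1 - z₂) * (E - F)
        ≤ z₂ / (1 - z₁ - m + (z₂ - z₁)) - z₂ / (1 - 2 * z₁ + z₂) := by nlinarith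
    refine le_of_mul_le_mul_left ?_ (sub_pos.2 hu)
    have := mul_le_mul_of_nonneg_left e1 hk
    linarith
  have hQP : (1 - z₂ - m) * (Q - P) ≤ m * ((1 - z₂) * E) := by
    have h1 : (1 - z₂ - m) * (Q - P) ≤ (1 - z₂ - m) * (E * m) :=
      mul_le_mul_of_nonneg_left (by linarith) hk
    have h2 : (1 - z₂ - m) * (E * m) ≤ (1 - z₂) * (E * m) :=
      mul_le_mul_of_nonneg_right (by linarith) (mul_nonneg hE0.le hm)
    linarith
  -- By `hlast` and `Q - R ≤ E w ≤ E (1 - z₁)`, the bracket is at least `E (z₂ - z₁) / 2`.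
  have hfin : 0 ≤ m * (2 - z₁ * E - (Q - R) / 2 - z₁ * (z₂ / (1 - 2 * z₁ + z₂) ^ 2)
      - (1 - z₂) * E / 2) := by
    refine mul_nonneg hm ?_
    nlinarith
  have := mul_le_mul_of_nonneg_left hEF (show 0 ≤ z₁ by linarith)
  linarith

end Admissible


/-! ### Captive demand and bounds on profits. -/

theorem captiveDemand_nonneg (z e p : ℝ) : 0 ≤ captiveDemand z e p := by
  unfold captiveDemand; split_ifs <;> norm_num

theorem captiveDemand_le_one (z e p : ℝ) : captiveDemand z e p ≤ 1 := by
  unfold captiveDemand; split_ifs <;> norm_num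

section

variable {z₁ z₂ p q : ℝ}

theorem captiveDemand₁_eq_one (hz₁ : 0 ≤ z₁) (hp : p ≤ 1 - z₁) : captiveDemand z₁ 0 p = 1 := by
  unfold captiveDemand utility
  rw [zero_sub, abs_neg, abs_of_nonneg hz₁, if_pos (by linarith)]

theorem captiveDemand₁_eq_zero (hz₁ : 0 ≤ z₁) (hp : 1 - z₁ < p) : captiveDemand z₁ 0 p = 0 := by
  unfold captiveDemand utility
  rw [zero_sub, abs_neg, abs_of_nonneg hz₁, if_neg (by linarith)]

theorem captiveDemand₂_eq_one (hz₂ : z₂ ≤ 1) (hq : q ≤ z₂) : captiveDemand z₂ 1 q = 1 := by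
  unfold captiveDemand utility
  rw [abs_of_nonneg (by linarith), if_pos (by linarith)]

theorem captiveDemand₂_eq_zero (hz₂ : z₂ ≤ 1) (hq : z₂ < q) : captiveDemand z₂ 1 q = 0 := by
  unfold captiveDemand utility
  rw [abs_of_nonneg (by linarith), if_neg (by linarith)]

theorem profit₁_nonneg (hp : 0 ≤ p) : 0 ≤ profit₁ z₁ z₂ p q :=
  mul_nonneg hp (add_nonneg (captiveDemand_nonneg _ _ _) (informedDemand_nonneg _ _ _ _))

theorem profit₂_nonneg (hq : 0 ≤ q) : 0 ≤ profit₂ z₁ z₂ p q :=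
  mul_nonneg hq (add_nonneg (captiveDemand_nonneg _ _ _) (informedDemand_nonneg _ _ _ _))

theorem profit₁_le (hp : 0 ≤ p) : profit₁ z₁ z₂ p q ≤ 2 * p := by
  have h1 := captiveDemand_le_one z₁ 0 p
  have h2 := informedDemand_le_one z₁ z₂ p q
  have := mul_le_mul_of_nonneg_left (add_le_add h1 h2) hp
  unfold profit₁
  linarith

theorem profit₂_le (hq : 0 ≤ q) : profit₂ z₁ z₂ p q ≤ 2 * q := by
  have h1 := captiveDemand_le_one z₂ 1 q
  have h2 := informedDemand_le_one z₂ z₁ q p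
  have := mul_le_mul_of_nonneg_left (add_le_add h1 h2) hq
  unfold profit₂
  linarith

theorem integral_densityWithAtom_mono {f φ ψ : ℝ → ℝ} {l r c x₀ : ℝ} (hφ : ∀ t, 0 ≤ φ t)
    (hψ : Integrable ψ (densityWithAtom f l r c x₀)) (h : ∀ t ∈ Ioc l r, φ t ≤ ψ t)
    (h₀ : φ x₀ ≤ ψ x₀) :
    ∫ t, φ t ∂densityWithAtom f l r c x₀ ≤ ∫ t, ψ t ∂densityWithAtom f l r c x₀ :=
  integral_mono_of_nonneg (ae_of_all _ hφ) hψ (ae_densityWithAtom h h₀)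

end

/-! ### The equilibrium price distributions. -/

/-- The price distribution of Firm 1. -/
def priceDist₁ (z₁ z₂ w : ℝ) : Measure ℝ :=
  densityWithAtom (dens₁ z₁ z₂) (1 - z₁ - w) (1 - z₁) (1 - cdf₁ z₁ z₂ (1 - z₁)) (1 - z₁)

/-- The price distribution of Firm 2. -/
def priceDist₂ (z₁ z₂ w : ℝ) : Measure ℝ :=
  densityWithAtom (dens₂ z₁ z₂ w) (1 - 2 * z₁ + z₂ - w) (1 - 2 * z₁ + z₂)
    (1 - cdf₂ z₁ z₂ w (1 - 2 * z₁ + z₂)) z₂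

namespace Admissible

variable {z₁ z₂ w : ℝ} (A : Admissible z₁ z₂ w)
include A

theorem le_captive_price₂ : 1 - 2 * z₁ + z₂ ≤ z₂ := by linarith [A.half_le]

theorem continuousOn_dens₁ : ContinuousOn (dens₁ z₁ z₂) (Icc (1 - z₁ - w) (1 - z₁)) :=
  fun _ ht => (hasDerivAt_dens₁ A.lt_one
    (A.add_pos_of_mem ht)).continuousAt.continuousWithinAt

theorem continuousOn_dens₂ :
    ContinuousOn (dens₂ z₁ z₂ w) (Icc (1 - 2 * z₁ + z₂ - w) (1 - 2 * z₁ + z₂)) :=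
  fun _ ht => (hasDerivAt_dens₂ A.lt_one
    (A.sub_pos_of_mem ht)).continuousAt.continuousWithinAt

theorem integral₁ {ψ : ℝ → ℝ} {a b c d s : ℝ} (hs : s ∈ Icc (1 - z₁ - w) (1 - z₁))
    (h₁ : ∀ t ∈ Ioo (1 - z₁ - w) s, ψ t = a + b * t)
    (h₂ : ∀ t ∈ Ioo s (1 - z₁), ψ t = c + d * t) :
    Integrable ψ (priceDist₁ z₁ z₂ w) ∧
      ∫ t, ψ t ∂priceDist₁ z₁ z₂ w
        = (a + b * s) * cdf₁ z₁ z₂ s - b * (prim₁ z₁ z₂ s - prim₁ z₁ z₂ (1 - z₁ - w))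
          + ((c + d * (1 - z₁)) * cdf₁ z₁ z₂ (1 - z₁) - d * prim₁ z₁ z₂ (1 - z₁))
          - ((c + d * s) * cdf₁ z₁ z₂ s - d * prim₁ z₁ z₂ s)
          + (1 - cdf₁ z₁ z₂ (1 - z₁)) * ψ (1 - z₁) := by
  obtain ⟨hi, he⟩ := integral_densityWithAtom (x₀ := 1 - z₁)
    (fun _ ht => hasDerivAt_cdf₁ A.lt_one (A.add_pos_of_mem ht))
    (fun _ ht => hasDerivAt_prim₁ A.lt_one (A.add_pos_of_mem ht)) A.continuousOn_dens₁
    A.dens₁_nonneg (sub_nonneg.2 A.cdf₁_right_le_one) hs h₁ h₂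
  refine ⟨hi, he.trans ?_⟩
  rw [A.root]
  ring

theorem integral₂ {ψ : ℝ → ℝ} {a b c d s : ℝ}
    (hs : s ∈ Icc (1 - 2 * z₁ + z₂ - w) (1 - 2 * z₁ + z₂))
    (h₁ : ∀ t ∈ Ioo (1 - 2 * z₁ + z₂ - w) s, ψ t = a + b * t)
    (h₂ : ∀ t ∈ Ioo s (1 - 2 * z₁ + z₂), ψ t = c + d * t) :
    Integrable ψ (priceDist₂ z₁ z₂ w) ∧
      ∫ t, ψ t ∂priceDist₂ z₁ z₂ w
        = (a + b * s) * cdf₂ z₁ z₂ w s - b * (prim₂ z₁ z₂ w s + 4)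
          + ((c + d * (1 - 2 * z₁ + z₂)) * cdf₂ z₁ z₂ w (1 - 2 * z₁ + z₂)
            - d * prim₂ z₁ z₂ w (1 - 2 * z₁ + z₂))
          - ((c + d * s) * cdf₂ z₁ z₂ w s - d * prim₂ z₁ z₂ w s)
          + (1 - cdf₂ z₁ z₂ w (1 - 2 * z₁ + z₂)) * ψ z₂ := by
  obtain ⟨hi, he⟩ := integral_densityWithAtom (x₀ := z₂)
    (fun _ ht => hasDerivAt_cdf₂ A.lt_one (A.sub_pos_of_mem ht))
    (fun _ ht => hasDerivAt_prim₂ A.lt_one (A.sub_pos_of_mem ht)) A.continuousOn_dens₂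
    A.dens₂_nonneg (sub_nonneg.2 A.cdf₂_le) hs h₁ h₂
  refine ⟨hi, he.trans ?_⟩
  rw [cdf₂_left A.lt_price, A.prim₂_left]
  ring

theorem measureReal₁ {S : Set ℝ} {s : ℝ} (hS : MeasurableSet S)
    (hs : s ∈ Icc (1 - z₁ - w) (1 - z₁)) (h₁ : Ioo (1 - z₁ - w) s ⊆ S)
    (h₂ : Disjoint (Ioo s (1 - z₁)) S) :
    (priceDist₁ z₁ z₂ w).real S
      = cdf₁ z₁ z₂ s + (1 - cdf₁ z₁ z₂ (1 - z₁)) * S.indicator 1 (1 - z₁) := by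
  have := measureReal_densityWithAtom (x₀ := 1 - z₁) hS
    (fun _ ht => hasDerivAt_cdf₁ A.lt_one (A.add_pos_of_mem ht))
    (fun _ ht => hasDerivAt_prim₁ A.lt_one (A.add_pos_of_mem ht)) A.continuousOn_dens₁
    A.dens₁_nonneg (sub_nonneg.2 A.cdf₁_right_le_one) hs h₁ h₂
  rwa [A.root, sub_zero] at this

theorem measureReal₂ {S : Set ℝ} {s : ℝ} (hS : MeasurableSet S)
    (hs : s ∈ Icc (1 - 2 * z₁ + z₂ - w) (1 - 2 * z₁ + z₂))
    (h₁ : Ioo (1 - 2 * z₁ + z₂ - w) s ⊆ S) (h₂ : Disjoint (Ioo s (1 - 2 * z₁ + z₂)) S) :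
    (priceDist₂ z₁ z₂ w).real S
      = cdf₂ z₁ z₂ w s + (1 - cdf₂ z₁ z₂ w (1 - 2 * z₁ + z₂)) * S.indicator 1 z₂ := by
  have := measureReal_densityWithAtom (x₀ := z₂) hS
    (fun _ ht => hasDerivAt_cdf₂ A.lt_one (A.sub_pos_of_mem ht))
    (fun _ ht => hasDerivAt_prim₂ A.lt_one (A.sub_pos_of_mem ht)) A.continuousOn_dens₂
    A.dens₂_nonneg (sub_nonneg.2 A.cdf₂_le) hs h₁ h₂
  rwa [cdf₂_left A.lt_price, sub_zero] at this

theorem isProbabilityMeasure₁ : IsProbabilityMeasure (priceDist₁ z₁ z₂ w) :=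
  isProbabilityMeasure_densityWithAtom A.left_mem.2
    (fun _ ht => hasDerivAt_cdf₁ A.lt_one (A.add_pos_of_mem ht))
    (fun _ ht => hasDerivAt_prim₁ A.lt_one (A.add_pos_of_mem ht)) A.continuousOn_dens₁
    A.dens₁_nonneg (sub_nonneg.2 A.cdf₁_right_le_one) A.root rfl

theorem isProbabilityMeasure₂ : IsProbabilityMeasure (priceDist₂ z₁ z₂ w) :=
  isProbabilityMeasure_densityWithAtom A.left_mem₂.2
    (fun _ ht => hasDerivAt_cdf₂ A.lt_one (A.sub_pos_of_mem ht))
    (fun _ ht => hasDerivAt_prim₂ A.lt_one (A.sub_pos_of_mem ht)) A.continuousOn_dens₂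
    A.dens₂_nonneg (sub_nonneg.2 A.cdf₂_le) (cdf₂_left A.lt_price) rfl

theorem isMixedStrategy₁ : IsMixedStrategy (priceDist₁ z₁ z₂ w) := by
  have := A.isProbabilityMeasure₁
  refine ⟨this, ?_⟩
  have h := A.measureReal₁ (S := Iio 0) measurableSet_Iio A.left_mem (by simp)
    (Set.disjoint_left.2 fun t ht h0 => by linarith [ht.1, A.lt_price, mem_Iio.1 h0])
  rw [A.root, indicator_of_notMem (notMem_Iio.2 (by linarith [A.lt, A.lt_one])), mul_zero,
    add_zero] at h
  exact (measureReal_eq_zero_iff).1 h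

theorem isMixedStrategy₂ : IsMixedStrategy (priceDist₂ z₁ z₂ w) := by
  have := A.isProbabilityMeasure₂
  refine ⟨this, ?_⟩
  have h := A.measureReal₂ (S := Iio 0) measurableSet_Iio A.left_mem₂ (by simp)
    (Set.disjoint_left.2 fun t ht h0 => by linarith [ht.1, A.lt_price, A.lt, mem_Iio.1 h0])
  rw [cdf₂_left A.lt_price, indicator_of_notMem (notMem_Iio.2 (by linarith [A.lt, A.half_le])),
    mul_zero, add_zero] at h
  exact (measureReal_eq_zero_iff).1 h

theorem measureReal_Iic₁ (p : ℝ) : (priceDist₁ z₁ z₂ w).real (Iic p) = F₁ z₁ z₂ w p := by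
  unfold F₁
  split_ifs with h1 h2
  · rw [A.measureReal₁ measurableSet_Iic A.left_mem (by simp)
      (Set.disjoint_left.2 fun t ht h0 => by linarith [ht.1, mem_Iic.1 h0]), A.root,
      indicator_of_notMem (notMem_Iic.2 (by linarith [A.pos]))]
    simp
  · rw [A.measureReal₁ measurableSet_Iic ⟨not_lt.1 h1, h2.le⟩ (fun t ht => ht.2.le)
      (Set.disjoint_left.2 fun t ht h0 => by linarith [ht.1, mem_Iic.1 h0]),
      indicator_of_notMem (notMem_Iic.2 h2)]
    simp [cdf₁]
  · rw [A.measureReal₁ measurableSet_Iic A.right_mem (fun t ht => ht.2.le.trans (not_lt.1 h2))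
      (by simp), indicator_of_mem (mem_Iic.2 (not_lt.1 h2))]
    simp

theorem measureReal_Iic₂ (p : ℝ) : (priceDist₂ z₁ z₂ w).real (Iic p) = F₂ z₁ z₂ w p := by
  have hz := A.le_captive_price₂
  unfold F₂
  split_ifs with h1 h2 h3
  · rw [A.measureReal₂ measurableSet_Iic A.left_mem₂ (by simp)
      (Set.disjoint_left.2 fun t ht h0 => by linarith [ht.1, mem_Iic.1 h0]),
      cdf₂_left A.lt_price, indicator_of_notMem (notMem_Iic.2 (by linarith [A.pos]))]
    simp
  · rw [A.measureReal₂ measurableSet_Iic ⟨not_lt.1 h1, h2.le⟩ (fun t ht => ht.2.le)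
      (Set.disjoint_left.2 fun t ht h0 => by linarith [ht.1, mem_Iic.1 h0]),
      indicator_of_notMem (notMem_Iic.2 (h2.trans_le hz))]
    simp [cdf₂]
  · rw [A.measureReal₂ measurableSet_Iic A.right_mem₂ (fun t ht => ht.2.le.trans (not_lt.1 h2))
      (by simp), indicator_of_notMem (notMem_Iic.2 h3)]
    simp [cdf₂]
  · rw [A.measureReal₂ measurableSet_Iic A.right_mem₂ (fun t ht => ht.2.le.trans (not_lt.1 h2))
      (by simp), indicator_of_mem (mem_Iic.2 (not_lt.1 h3))]
    simp

theorem measureReal_singleton₁ :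
    (priceDist₁ z₁ z₂ w).real {1 - z₁} = 1 - cdf₁ z₁ z₂ (1 - z₁) := by
  rw [A.measureReal₁ (measurableSet_singleton _) A.left_mem (by simp) (by simp), A.root]
  simp

theorem measureReal_singleton₂ :
    (priceDist₂ z₁ z₂ w).real {z₂} = 1 - cdf₂ z₁ z₂ w (1 - 2 * z₁ + z₂) := by
  rw [A.measureReal₂ (measurableSet_singleton _) A.left_mem₂ (by simp)
    (Set.disjoint_singleton_right.2 fun h => absurd h.2 (not_lt.2 A.le_captive_price₂)),
    cdf₂_left A.lt_price]
  simp

/-! ### Indifference on the supports and equilibrium profits. -/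

/-- Firm 1's indifference on the support of its strategy. -/
theorem integral_indifference₁ {ψ : ℝ → ℝ} {p : ℝ} (hp : p ∈ Icc (1 - z₁ - w) (1 - z₁))
    (h₁ : ∀ q ∈ Ioo (1 - 2 * z₁ + z₂ - w) (p + (z₂ - z₁)),
      ψ q = p * (1 + (z₁ + z₂ + q - p) / 2))
    (h₂ : ∀ q ∈ Ioo (p + (z₂ - z₁)) (1 - 2 * z₁ + z₂), ψ q = 2 * p) (h₃ : ψ z₂ = 2 * p) :
    Integrable ψ (priceDist₂ z₁ z₂ w) ∧
      ∫ q, ψ q ∂priceDist₂ z₁ z₂ w = 2 * (1 - z₁ - w) := by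
  obtain ⟨hi, he⟩ := A.integral₂ (ψ := ψ) (s := p + (z₂ - z₁))
    (a := p * (1 + (z₁ + z₂ - p) / 2)) (b := p / 2) (c := 2 * p) (d := 0)
    ⟨by linarith [hp.1], by linarith [hp.2]⟩ (fun q hq => by rw [h₁ q hq]; ring)
    (fun q hq => by rw [h₂ q hq]; ring)
  refine ⟨hi, he.trans ?_⟩
  have hp0 : p ≠ 0 := by linarith [hp.1, A.lt_price]
  rw [h₃]
  unfold prim₂
  rw [add_sub_cancel_right]
  have : p * (4 * (1 - z₁ - w) / p) = 4 * (1 - z₁ - w) := mul_div_cancel₀ _ hp0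
  linear_combination this / 2

/-- Firm 2's indifference on the interval part of the support of its strategy. -/
theorem integral_indifference₂ {ψ : ℝ → ℝ} {q : ℝ}
    (hq : q ∈ Icc (1 - 2 * z₁ + z₂ - w) (1 - 2 * z₁ + z₂))
    (h₁ : ∀ p ∈ Ioo (1 - z₁ - w) (q - (z₂ - z₁)), ψ p = q)
    (h₂ : ∀ p ∈ Ioo (q - (z₂ - z₁)) (1 - z₁), ψ p = q * (2 - (z₁ + z₂ + q - p) / 2))
    (h₃ : ψ (1 - z₁) = q * (2 - (z₁ + z₂ + q - (1 - z₁)) / 2)) :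
    Integrable ψ (priceDist₁ z₁ z₂ w) ∧ ∫ p, ψ p ∂priceDist₁ z₁ z₂ w = z₂ := by
  obtain ⟨hi, he⟩ := A.integral₁ (ψ := ψ) (s := q - (z₂ - z₁)) (a := q) (b := 0)
    (c := q * (2 - (z₁ + z₂ + q) / 2)) (d := q / 2)
    ⟨by linarith [hq.1], by linarith [hq.2]⟩ (fun p hp => by rw [h₁ p hp]; ring)
    (fun p hp => by rw [h₂ p hp]; ring)
  refine ⟨hi, he.trans ?_⟩
  have hq0 : q ≠ 0 := by linarith [hq.1, A.lt_price, A.lt]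
  rw [h₃, A.prim₁_right]
  unfold prim₁
  rw [sub_add_cancel]
  have : q * (2 * z₂ / q) = 2 * z₂ := mul_div_cancel₀ _ hq0
  linear_combination this / 2

theorem profit₁_eq_left {p q : ℝ} (hp : p ≤ 1 - z₁) (hq : 1 - 2 * z₁ + z₂ - w ≤ q)
    (hqp : q < p + (z₂ - z₁)) : profit₁ z₁ z₂ p q = p * (1 + (z₁ + z₂ + q - p) / 2) := by
  unfold profit₁
  rw [captiveDemand₁_eq_one (by linarith [A.half_le]) hp,
    informedDemand₁_eq A.half_le A.lt A.lt_one.le hp hqp (by linarith [A.width_lt])]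

theorem profit₁_eq_right {p q : ℝ} (hp : p ≤ 1 - z₁) (hqp : p + (z₂ - z₁) < q) :
    profit₁ z₁ z₂ p q = 2 * p := by
  unfold profit₁
  rw [captiveDemand₁_eq_one (by linarith [A.half_le]) hp,
    informedDemand₁_eq_one A.half_le A.lt hp hqp]
  ring

theorem profit₂_eq_left {p q : ℝ} (hq : q ≤ z₂) (hpq : p + (z₂ - z₁) < q) :
    profit₂ z₁ z₂ p q = q := by
  unfold profit₂
  rw [captiveDemand₂_eq_one A.lt_one.le hq, informedDemand₂_eq_zero A.lt hpq]
  ring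

theorem profit₂_eq_right {p q : ℝ} (hp : p ≤ 1 - z₁) (hq : q ≤ z₂)
    (hpq : q < p + (z₂ - z₁)) (hqp : p < q + (z₂ - z₁)) :
    profit₂ z₁ z₂ p q = q * (2 - (z₁ + z₂ + q - p) / 2) := by
  unfold profit₂
  rw [captiveDemand₂_eq_one A.lt_one.le hq,
    informedDemand₂_eq A.half_le A.lt A.lt_one.le hp hpq hqp]
  ring

theorem expectedProfit₁_eq {p : ℝ} (hp : p ∈ Icc (1 - z₁ - w) (1 - z₁)) (hpz : p < z₁) :
    expectedProfit₁ z₁ z₂ (priceDist₂ z₁ z₂ w) p = 2 * (1 - z₁ - w) :=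
  (A.integral_indifference₁ hp (fun _ hq => A.profit₁_eq_left hp.2 hq.1.le hq.2)
    (fun _ hq => A.profit₁_eq_right hp.2 hq.1)
    (A.profit₁_eq_right hp.2 (by linarith))).2

theorem expectedProfit₂_eq {q : ℝ}
    (hq : q ∈ Ico (1 - 2 * z₁ + z₂ - w) (1 - 2 * z₁ + z₂)) :
    expectedProfit₂ z₁ z₂ (priceDist₁ z₁ z₂ w) q = z₂ := by
  have hz := A.le_captive_price₂
  have hw := A.width_lt
  exact (A.integral_indifference₂ ⟨hq.1, hq.2.le⟩
    (fun p hp => A.profit₂_eq_left (hq.2.le.trans hz) (by linarith [hp.2]))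
    (fun p hp => A.profit₂_eq_right hp.2.le (hq.2.le.trans hz) (by linarith [hp.1])
      (by linarith [hp.2, hq.1]))
    (A.profit₂_eq_right le_rfl (hq.2.le.trans hz) (by linarith [hq.2]) (by linarith [hq.1]))).2

/-- At `z₁ = 1/2` the prices `1 - z₁` and `z₂` differ by exactly δ and tie, but then Firm 1 has no
atom at `1 - z₁`, so the tie carries no weight. -/
theorem half_lt_or_eq : 1 / 2 < z₁ ∨ z₁ = 1 / 2 ∧ cdf₁ z₁ z₂ (1 - z₁) = 1 := by
  rcases A.half_le.lt_or_eq with h | h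
  · exact Or.inl h
  · refine Or.inr ⟨h.symm, ?_⟩
    have : z₂ ≠ 0 := by linarith [A.lt]
    rw [cdf₁_right A.lt_one, ← h, show 1 - 2 * (1 / 2) + z₂ = z₂ by ring, div_self this]
    simp

theorem expectedProfit₂_captive :
    expectedProfit₂ z₁ z₂ (priceDist₁ z₁ z₂ w) z₂ = z₂ := by
  have hz := A.le_captive_price₂
  obtain ⟨-, he⟩ := A.integral₁ (ψ := fun p => profit₂ z₁ z₂ p z₂) (s := 1 - z₁) (a := z₂)
    (b := 0) (c := 0) (d := 0) A.right_mem
    (fun p hp => by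
      rw [A.profit₂_eq_left le_rfl (by linarith [hp.2])]; ring)
    (fun p hp => absurd (hp.1.trans hp.2) (lt_irrefl _))
  refine he.trans ?_
  rcases A.half_lt_or_eq with h | ⟨-, h⟩
  · rw [A.profit₂_eq_left le_rfl (by linarith)]
    ring
  · rw [h]
    ring

theorem mixedProfit₁_eq :
    mixedProfit₁ z₁ z₂ (priceDist₁ z₁ z₂ w) (priceDist₂ z₁ z₂ w) = 2 * (1 - z₁ - w) := by
  have hz := A.half_le
  obtain ⟨-, he⟩ := A.integral₁ (ψ := expectedProfit₁ z₁ z₂ (priceDist₂ z₁ z₂ w))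
    (s := 1 - z₁) (a := 2 * (1 - z₁ - w)) (b := 0) (c := 0) (d := 0) A.right_mem
    (fun p hp => by
      rw [A.expectedProfit₁_eq ⟨hp.1.le, hp.2.le⟩ (by linarith [hp.2])]; ring)
    (fun p hp => absurd (hp.1.trans hp.2) (lt_irrefl _))
  refine he.trans ?_
  rcases A.half_lt_or_eq with h | ⟨-, h⟩
  · rw [A.expectedProfit₁_eq A.right_mem (by linarith)]
    ring
  · rw [h]
    ring

theorem mixedProfit₂_eq :
    mixedProfit₂ z₁ z₂ (priceDist₁ z₁ z₂ w) (priceDist₂ z₁ z₂ w) = z₂ := by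
  obtain ⟨-, he⟩ := A.integral₂ (ψ := expectedProfit₂ z₁ z₂ (priceDist₁ z₁ z₂ w))
    (s := 1 - 2 * z₁ + z₂) (a := z₂) (b := 0) (c := 0) (d := 0) A.right_mem₂
    (fun q hq => by rw [A.expectedProfit₂_eq ⟨hq.1.le, hq.2⟩]; ring)
    (fun q hq => absurd (hq.1.trans hq.2) (lt_irrefl _))
  refine he.trans ?_
  rw [A.expectedProfit₂_captive]
  ring

/-! ### No profitable deviations. -/

theorem expectedProfit₁_le_of_forall {p v : ℝ} (hp : 0 ≤ p)
    (h : ∀ q, profit₁ z₁ z₂ p q ≤ v) :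
    expectedProfit₁ z₁ z₂ (priceDist₂ z₁ z₂ w) p ≤ v := by
  have := A.isProbabilityMeasure₂
  refine (integral_mono_of_nonneg (ae_of_all _ fun q => profit₁_nonneg hp)
    (integrable_const v) (ae_of_all _ h)).trans ?_
  simp

theorem expectedProfit₂_le_of_forall {q v : ℝ} (hq : 0 ≤ q)
    (h : ∀ p ∈ Ioc (1 - z₁ - w) (1 - z₁), profit₂ z₁ z₂ p q ≤ v) :
    expectedProfit₂ z₁ z₂ (priceDist₁ z₁ z₂ w) q ≤ v := by
  have := A.isProbabilityMeasure₁
  refine (integral_densityWithAtom_mono (fun p => profit₂_nonneg hq)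
    (integrable_const (μ := priceDist₁ z₁ z₂ w) v) h
    (h _ ⟨by linarith [A.pos], le_rfl⟩)).trans ?_
  change ∫ _, v ∂priceDist₁ z₁ z₂ w ≤ v
  simp

theorem expectedProfit₁_le {p : ℝ} (hp : 0 ≤ p) :
    expectedProfit₁ z₁ z₂ (priceDist₂ z₁ z₂ w) p ≤ 2 * (1 - z₁ - w) := by
  rcases le_or_gt p (1 - z₁ - w) with h1 | h1
  · exact A.expectedProfit₁_le_of_forall hp fun q => (profit₁_le hp).trans (by linarith)
  rcases le_or_gt p (1 - z₁) with h2 | h2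
  · have hz := A.le_captive_price₂
    obtain ⟨hi, he⟩ := A.integral_indifference₁ (p := p)
      (ψ := fun q => if q < p + (z₂ - z₁) then p * (1 + (z₁ + z₂ + q - p) / 2) else 2 * p)
      ⟨h1.le, h2⟩ (fun q hq => if_pos hq.2) (fun q hq => if_neg (not_lt.2 hq.1.le))
      (if_neg (not_lt.2 (by linarith)))
    refine le_trans (integral_densityWithAtom_mono (fun q => profit₁_nonneg hp) hi
      (fun q hq => ?_) ?_) he.le
    · split_ifs with h
      · exact (A.profit₁_eq_left h2 hq.1.le h).le
      · exact profit₁_le hp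
    · rw [if_neg (not_lt.2 (by linarith))]
      exact profit₁_le hp
  · refine A.expectedProfit₁_le_of_forall hp fun q => ?_
    have h3 := mul_informedDemand₁_le (z₂ := z₂) A.half_le A.le_two_thirds h2 q
    have h4 := A.width_le_sq
    unfold profit₁
    rw [captiveDemand₁_eq_zero (by linarith [A.half_le]) h2, zero_add]
    linarith

theorem expectedProfit₂_le {q : ℝ} (hq : 0 ≤ q) :
    expectedProfit₂ z₁ z₂ (priceDist₁ z₁ z₂ w) q ≤ z₂ := by
  have hz := A.le_captive_price₂
  have hw := A.width_lt
  have hlt := A.lt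
  have hone := A.lt_one
  have hhalf := A.half_le
  have hw0 := A.pos
  rcases lt_or_ge z₂ q with h1 | h1
  · refine A.expectedProfit₂_le_of_forall hq fun p hp => ?_
    unfold profit₂
    rw [captiveDemand₂_eq_zero A.lt_one.le h1,
      informedDemand₂_eq_zero A.lt (by linarith [hp.2])]
    linarith
  rcases lt_or_ge (1 - 2 * z₁ + z₂) q with h2 | h2
  · refine A.expectedProfit₂_le_of_forall hq fun p hp => ?_
    rw [A.profit₂_eq_left h1 (by linarith [hp.2])]
    exact h1
  rcases le_or_gt (1 - 2 * z₁ + z₂ - w) q with h3 | h3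
  · obtain ⟨hi, he⟩ := A.integral_indifference₂ (q := q)
      (ψ := fun p => if p < q - (z₂ - z₁) then q else q * (2 - (z₁ + z₂ + q - p) / 2))
      ⟨h3, h2⟩ (fun p hp => if_pos hp.2) (fun p hp => if_neg (not_lt.2 hp.1.le))
      (if_neg (not_lt.2 (by linarith)))
    have key : ∀ p ∈ Ioc (1 - z₁ - w) (1 - z₁), profit₂ z₁ z₂ p q
        ≤ if p < q - (z₂ - z₁) then q else q * (2 - (z₁ + z₂ + q - p) / 2) := by
      intro p hp
      split_ifs with h
      · exact (A.profit₂_eq_left h1 (by linarith)).le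
      · rcases (not_lt.1 h).lt_or_eq with h' | h'
        · exact (A.profit₂_eq_right hp.2 h1 (by linarith) (by linarith [hp.2])).le
        · unfold profit₂
          refine mul_le_mul_of_nonneg_left ?_ hq
          have h4 := captiveDemand_le_one z₂ 1 q
          have h5 := informedDemand₂_le (p := p) (q := q) A.lt hone.le (by linarith)
          linarith
    exact le_trans (integral_densityWithAtom_mono (fun p => profit₂_nonneg hq) hi key
      (key _ ⟨by linarith, le_rfl⟩)) he.le
  -- Just below the support every price of Firm 1 still splits the market, so profit is a quadratic
  -- in `q` that increases up to the lowest support price.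
  rcases lt_or_ge (1 - z₁ - (z₂ - z₁)) q with h4 | h4
  · obtain ⟨hi, he⟩ := A.integral_indifference₂ (q := 1 - 2 * z₁ + z₂ - w)
      (ψ := fun p => (1 - 2 * z₁ + z₂ - w)
        * (2 - (z₁ + z₂ + (1 - 2 * z₁ + z₂ - w) - p) / 2))
      A.left_mem₂ (fun p hp => absurd (hp.1.trans hp.2) (not_lt.2 (by linarith)))
      (fun p hp => rfl) rfl
    have key : ∀ p ∈ Ioc (1 - z₁ - w) (1 - z₁), profit₂ z₁ z₂ p q
        ≤ (1 - 2 * z₁ + z₂ - w) * (2 - (z₁ + z₂ + (1 - 2 * z₁ + z₂ - w) - p) / 2) := by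
      intro p hp
      rw [A.profit₂_eq_right hp.2 h1 (by linarith [hp.1]) (by linarith [hp.2])]
      have := mul_nonneg (sub_nonneg.2 h3.le) (show 0 ≤ 2 - (z₁ + z₂ - p) / 2
        - ((1 - 2 * z₁ + z₂ - w) + q) / 2 by linarith [hp.1, A.lt_price])
      linarith
    exact le_trans (integral_densityWithAtom_mono (fun p => profit₂_nonneg hq) hi key
      (key _ ⟨by linarith, le_rfl⟩)) he.le
  rcases le_or_gt (1 - z₁ - w) (q + (z₂ - z₁)) with h5 | h5
  · have hx : q + (z₂ - z₁) ∈ Icc (1 - z₁ - w) (1 - z₁) := ⟨h5, by linarith⟩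
    obtain ⟨hi, he⟩ := A.integral₁ (s := q + (z₂ - z₁))
      (ψ := fun p => if p < q + (z₂ - z₁) then q * (2 - (z₁ + z₂ + q - p) / 2) else 2 * q)
      (a := q * (2 - (z₁ + z₂ + q) / 2)) (b := q / 2) (c := 2 * q) (d := 0)
      hx (fun p hp => by rw [if_pos hp.2]; ring)
      (fun p hp => by rw [if_neg (not_lt.2 hp.1.le)]; ring)
    have key : ∀ p ∈ Ioc (1 - z₁ - w) (1 - z₁), profit₂ z₁ z₂ p q
        ≤ if p < q + (z₂ - z₁) then q * (2 - (z₁ + z₂ + q - p) / 2) else 2 * q := by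
      intro p hp
      split_ifs with h
      · exact (A.profit₂_eq_right hp.2 h1 (by linarith [hp.1]) h).le
      · exact profit₂_le hq
    refine le_trans (integral_densityWithAtom_mono (fun p => profit₂_nonneg hq) hi key
      (key _ ⟨by linarith, le_rfl⟩)) ?_
    have hu := A.undercut_le hx (by linarith)
    refine (he.trans ?_).le.trans hu
    rw [if_neg (not_lt.2 (by linarith))]
    ring
  · refine A.expectedProfit₂_le_of_forall hq fun p _ => (profit₂_le hq).trans ?_
    -- At the left end the undercutting bound reads `2 (1 - z₁ - w - δ) ≤ z₂`, and a price that
    -- undercuts all of Firm 1's prices earns at most this.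
    have hu := A.undercut_le A.left_mem (by linarith)
    rw [A.root] at hu
    linarith

theorem isPriceEquilibrium :
    IsPriceEquilibrium z₁ z₂ (priceDist₁ z₁ z₂ w) (priceDist₂ z₁ z₂ w) where
  strategy₁ := A.isMixedStrategy₁
  strategy₂ := A.isMixedStrategy₂
  noDeviation₁ _ hp := (A.expectedProfit₁_le hp).trans_eq A.mixedProfit₁_eq.symm
  noDeviation₂ _ hq := (A.expectedProfit₂_le hq).trans_eq A.mixedProfit₂_eq.symm

end Admissible

end PriceGame

end

theorem proposition9 (z₁ z₂ w : ℝ)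
    (hz₁ : 1 / 2 ≤ z₁) (hz₁₂ : z₁ < z₂) (hz₂ : z₂ ≤ 1)
    (hregion : (1 - 2 * z₁ + z₂) * (2 - z₂) > z₂)
    (hw_pos : 0 < w) (hw_lt : w < 1 - z₁)
    (hw_root : PriceGame.g₀ z₁ z₂ (1 - z₁ - w) (1 - z₁)
      - z₂ * PriceGame.gπ z₁ z₂ (1 - z₁ - w) (1 - z₁) = 0)
    (hcond_a : PriceGame.h z₁ z₂ (1 - 2 * z₁ + z₂) (1 - 2 * z₁ + z₂ - w) ≤ 1)
    (hcond_b : (z₂ - z₁) * z₂ + 2 * z₁ + (1 - z₂) * w / 2 - z₁ * z₂ / (1 - 2 * z₁ + z₂)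
      - (1 - z₂) * z₂ / (1 - 2 * z₁ + z₂ - w) ≥ 0) :
    ∃ μ₁ μ₂ : MeasureTheory.Measure ℝ,
      PriceGame.IsPriceEquilibrium z₁ z₂ μ₁ μ₂ ∧
      (∀ p : ℝ, μ₁.real (Set.Iic p) = PriceGame.F₁ z₁ z₂ w p) ∧
      (∀ p : ℝ, μ₂.real (Set.Iic p) = PriceGame.F₂ z₁ z₂ w p) ∧
      μ₁.real {1 - z₁} = 1 - PriceGame.g z₁ z₂ (1 - z₁) (1 - z₁) z₂ ∧
      μ₂.real {z₂} = 1 - PriceGame.h z₁ z₂ (1 - 2 * z₁ + z₂) (1 - 2 * z₁ + z₂ - w) ∧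
      PriceGame.mixedProfit₁ z₁ z₂ μ₁ μ₂ = 2 * (1 - z₁ - w) ∧
      PriceGame.mixedProfit₂ z₁ z₂ μ₁ μ₂ = z₂ := by
  have A : PriceGame.Admissible z₁ z₂ w :=
    { half_le := hz₁
      lt := hz₁₂
      lt_one := lt_of_le_of_ne hz₂ (by rintro rfl; linarith)
      region := hregion
      pos := hw_pos
      lt_price := hw_lt
      root := hw_root
      cdf₂_le := hcond_a
      undercut := hcond_b }
  exact ⟨_, _, A.isPriceEquilibrium, A.measureReal_Iic₁, A.measureReal_Iic₂,
    A.measureReal_singleton₁, A.measureReal_singleton₂, A.mixedProfit₁_eq, A.mixedProfit₂_eq⟩
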